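/- Let $X$ be a Banach space over $\mathbb{K}\in\{\mathbb{R},\mathbb{C}\}$, let $X^*$ be its (continuous) dual, and let $B_{X^*}$ be the closed unit ball of $X^*$ equipped with the weak* topology. "Isomorphic" means linearly homeomorphic; $c_0$ and $\ell_2$ denote the usual spaces of $\mathbb{K}$-valued null sequences and square-summable sequences, with their usual norms. (1) If $B_{X^*}$ is not sequentially compact, then there is a closed linear subspace $M\subseteq X$ such that the quotient $X/M$ is separable and is isomorphic to $c_0$ or to $\ell_2$. (2) If $B_{X^*}$ is sequentially compact, then $X$ contains a closed linear subspace isomorphic to $c_0$ if and only if $X$ contains a closed linear subspace that is isomorphic to $c_0$ and is complemented in $X$, i.e. is the range of a continuous linear projection of $X$. -/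

import Mathlib

open scoped ZeroAtInfty

/-- The Banach space `c₀` of null sequences of scalars with the supremum norm (a function on the
discrete space `ℕ` vanishes at infinity iff it is a null sequence). -/
abbrev CZero (𝕜 : Type*) [RCLike 𝕜] : Type _ := C₀(ℕ, 𝕜)

/-- The Hilbert space `ℓ₂` of square-summable sequences of scalars. -/
abbrev EllTwo (𝕜 : Type*) [RCLike 𝕜] : Type _ := lp (fun _ : ℕ => 𝕜) 2

/-- The closed unit ball of the dual of `X`, as a subset of the dual with its weak* topology. -/
def dualUnitBall (𝕜 X : Type*) [RCLike 𝕜] [NormedAddCommGroup X] [NormedSpace 𝕜 X] :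
    Set (WeakDual 𝕜 X) :=
  WeakDual.toStrongDual ⁻¹' Metric.closedBall (0 : StrongDual 𝕜 X) 1

/-- `X` has a separable quotient, by a closed linear subspace, that is (linearly and topologically)
isomorphic to `Z`. -/
def HasSeparableQuotientIsoTo (𝕜 X Z : Type*) [RCLike 𝕜] [NormedAddCommGroup X] [NormedSpace 𝕜 X]
    [NormedAddCommGroup Z] [NormedSpace 𝕜 Z] : Prop :=
  ∃ M : Submodule 𝕜 X, IsClosed (M : Set X) ∧ TopologicalSpace.SeparableSpace (X ⧸ M) ∧
    Nonempty ((X ⧸ M) ≃L[𝕜] Z)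

/-- `X` contains a copy of `Z`: a closed linear subspace isomorphic to `Z`. -/
def ContainsCopy (𝕜 X Z : Type*) [RCLike 𝕜] [NormedAddCommGroup X] [NormedSpace 𝕜 X]
    [NormedAddCommGroup Z] [NormedSpace 𝕜 Z] : Prop :=
  ∃ M : Submodule 𝕜 X, IsClosed (M : Set X) ∧ Nonempty (M ≃L[𝕜] Z)

/-- `X` contains a complemented copy of `Z`: a closed linear subspace isomorphic to `Z` that is the
range of a continuous linear projection of `X`. -/
def ContainsComplementedCopy (𝕜 X Z : Type*) [RCLike 𝕜] [NormedAddCommGroup X] [NormedSpace 𝕜 X]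
    [NormedAddCommGroup Z] [NormedSpace 𝕜 Z] : Prop :=
  ∃ M : Submodule 𝕜 X, IsClosed (M : Set X) ∧ M.ClosedComplemented ∧ Nonempty (M ≃L[𝕜] Z)

/-! Part (1). Non-compactness gives functionals in the dual ball none of whose subsequences
converges pointwise. Seen as functions on the unit ball of `X`, they satisfy a Rosenthal dichotomy
(`exists_independent_subsequence`): some subsequence takes two separated values independently, up to
a small error. This yields a lower `ℓ₁` estimate in the dual (`le_norm_sum_of_independent`).

Measure a normalised disjoint block sequence of these functionals by the supremum over the unit ball
of its upper limits. This size cannot grow under refinement, so a diagonal argument produces blocks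
on which it is stable, equal to some `δ` (`exists_stable_isBlockSeq`). If `δ = 0`, the blocks are
weak* null and still satisfy the `ℓ₁` estimate, and evaluating them maps `X` onto `c₀`
(`toCZero_surjective`).

If `δ > 0`, stability says that signed averages of disjoint subsequences still have size `δ`. An
average can be that large only if all its terms are nearly extremal, so one vector gives prescribed
values `±δ` along finitely many subsequences at once. Iterating gives vectors `x k` on which every
sign pattern is nearly attained in the dual ball (`exists_attainsSigns`, `exists_dual_signs`).
Choose functionals indexed by sign vectors and let `φ k` be weak* limits of their Rademacher
averages. Bessel's inequality makes `(φ k)` an operator into `ℓ₂`; Khintchine's inequality, tested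
on the `x k` with matching signs, bounds its adjoint below, so it is onto.

Part (2). Extend the coordinate functionals of a copy of `c₀` and pass to a weak* convergent
subsequence. Differences of consecutive terms are weak* null, hence define an operator into `c₀`
that inverts the embedding on a subsequence of the basis. -/

open Filter Topology

/-! ### Surjectivity criteria and quotients. -/

section Surjectivity

variable {𝕜 X Y : Type*} [RCLike 𝕜] [NormedAddCommGroup X] [NormedSpace 𝕜 X]
  [NormedAddCommGroup Y] [NormedSpace 𝕜 Y]

theorem RCLike.exists_norm_one_mul_eq_norm (z : 𝕜) : ∃ θ : 𝕜, ‖θ‖ = 1 ∧ θ * z = (‖z‖ : 𝕜) := by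
  by_cases hz : z = 0
  · exact ⟨1, by simp, by simp [hz]⟩
  · have hz' : (‖z‖ : 𝕜) ≠ 0 := by simpa using hz
    refine ⟨(‖z‖ : 𝕜) / z, by simp [hz], by field_simp⟩

/-- If every `y` can be approximated up to half its norm by images of controlled vectors, then
the operator is onto. -/
theorem ContinuousLinearMap.surjective_of_exists_approx [CompleteSpace X] (T : X →L[𝕜] Y) {C : ℝ}
    (h : ∀ y, ∃ x, ‖y - T x‖ ≤ 1 / 2 * ‖y‖ ∧ ‖x‖ ≤ C * ‖y‖) : Function.Surjective T := by
  intro y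
  have hC : 0 ≤ C * ‖y‖ := by
    obtain ⟨x, -, hx⟩ := h y
    exact (norm_nonneg x).trans hx
  choose g hg using h
  let r : Y → Y := fun y => y - T (g y)
  have hnle : ∀ n : ℕ, ‖r^[n] y‖ ≤ (1 / 2) ^ n * ‖y‖ := by
    intro n
    induction n with
    | zero => simp
    | succ n IH =>
      rw [Function.iterate_succ_apply', pow_succ', mul_assoc]
      exact (hg _).1.trans (by gcongr)
  let u : ℕ → X := fun n => g (r^[n] y)
  have ule : ∀ n, ‖u n‖ ≤ (1 / 2) ^ n * (C * ‖y‖) := by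
    intro n
    rcases eq_or_ne y 0 with rfl | hy
    · have h0 : r^[n] (0 : Y) = 0 := by simpa using hnle n
      have := (hg (r^[n] (0 : Y))).2
      simpa [u, h0] using this
    · have hC' : 0 ≤ C := nonneg_of_mul_nonneg_left hC (norm_pos_iff.2 hy)
      calc ‖u n‖ ≤ C * ‖r^[n] y‖ := (hg _).2
        _ ≤ C * ((1 / 2) ^ n * ‖y‖) := by gcongr; exact hnle n
        _ = (1 / 2) ^ n * (C * ‖y‖) := by ring
  have su : Summable u := by
    refine Summable.of_norm (.of_nonneg_of_le (fun n => norm_nonneg _) ule ?_)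
    exact Summable.mul_right _ (summable_geometric_of_lt_one (by simp) (by norm_num))
  have hsum : ∀ n : ℕ, T (∑ i ∈ Finset.range n, u i) = y - r^[n] y := by
    intro n
    induction n with
    | zero => simp
    | succ n IH =>
      rw [Finset.sum_range_succ, map_add, IH, Function.iterate_succ_apply']
      simp only [r, u]
      abel
  refine ⟨∑' n, u n, ?_⟩
  have L₁ : Tendsto (fun n => T (∑ i ∈ Finset.range n, u i)) atTop (𝓝 (T (∑' n, u n))) :=
    (T.continuous.tendsto _).comp su.hasSum.tendsto_sum_nat
  have L₂ : Tendsto (fun n => y - r^[n] y) atTop (𝓝 (y - 0)) := by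
    refine tendsto_const_nhds.sub (squeeze_zero_norm hnle ?_)
    rw [← zero_mul ‖y‖]
    exact (tendsto_pow_atTop_nhds_zero_of_lt_one (by norm_num) (by norm_num)).mul
      tendsto_const_nhds
  simp only [hsum] at L₁
  simpa using tendsto_nhds_unique L₁ L₂

/-- An operator whose adjoint is bounded below is onto. -/
theorem ContinuousLinearMap.surjective_of_le_norm_comp [CompleteSpace X] (T : X →L[𝕜] Y) {c : ℝ}
    (hc : 0 < c) (h : ∀ ψ : StrongDual 𝕜 Y, c * ‖ψ‖ ≤ ‖ψ.comp T‖) : Function.Surjective T := by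
  let : NormedSpace ℝ Y := NormedSpace.restrictScalars ℝ 𝕜 Y
  have : IsScalarTower ℝ 𝕜 Y := RestrictScalars.isScalarTower _ _ _
  let : NormedSpace ℝ X := NormedSpace.restrictScalars ℝ 𝕜 X
  have : IsScalarTower ℝ 𝕜 X := RestrictScalars.isScalarTower _ _ _
  refine T.surjective_of_exists_approx (C := 1 / c) fun y => ?_
  rcases eq_or_ne y 0 with rfl | hy
  · exact ⟨0, by simp, by simp⟩
  have hy' : 0 < ‖y‖ := norm_pos_iff.2 hy
  set r : ℝ := 1 / c * ‖y‖ with hr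
  have hr0 : 0 < r := by positivity
  have hconv : Convex ℝ (closure (T '' Metric.closedBall 0 r)) :=
    ((convex_closedBall (0 : X) r).is_linear_image (f := T)
      ⟨T.map_add, fun a x => by
        rw [← algebraMap_smul 𝕜 a x, ← algebraMap_smul 𝕜 a (T x), T.map_smul]⟩).closure
  have hmem : y ∈ closure (T '' Metric.closedBall 0 r) := by
    -- A functional separating `y` from the image of the `r`-ball satisfies `‖ψ ∘ T‖ ≤ u / r`. With
    -- `r = ‖y‖ / c` the lower bound turns this into `‖ψ‖ * ‖y‖ ≤ u < re (ψ y)`, which is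
    -- impossible.
    by_contra hy2
    obtain ⟨ψ, u, h1, h2⟩ := RCLike.geometric_hahn_banach_closed_point (𝕜 := 𝕜) hconv
      isClosed_closure hy2
    have hb : ∀ x, ‖x‖ ≤ r → ‖ψ (T x)‖ ≤ u := by
      intro x hx
      obtain ⟨θ, hθ, he⟩ := RCLike.exists_norm_one_mul_eq_norm (ψ (T x))
      have := h1 (T (θ • x)) (subset_closure ⟨θ • x, by simpa [norm_smul, hθ] using hx, rfl⟩)
      rw [map_smul, map_smul, smul_eq_mul, he, RCLike.ofReal_re] at this
      exact this.le
    have hu : 0 ≤ u := (norm_nonneg _).trans (hb 0 (by simpa using hr0.le))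
    have hn : ‖ψ.comp T‖ ≤ u / r := by
      refine ContinuousLinearMap.opNorm_le_bound _ (by positivity) fun x => ?_
      rcases eq_or_ne x 0 with rfl | hx
      · simp
      have hx' : 0 < ‖x‖ := norm_pos_iff.2 hx
      have := hb (((r / ‖x‖ : ℝ) : 𝕜) • x) (by
        rw [norm_smul, RCLike.norm_ofReal, abs_of_pos (by positivity)]
        exact (div_mul_cancel₀ _ hx'.ne').le)
      rw [map_smul, map_smul, norm_smul, RCLike.norm_ofReal, abs_of_pos (by positivity)] at this
      rw [ContinuousLinearMap.comp_apply]
      rw [div_mul_eq_mul_div, div_le_iff₀ hx'] at this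
      rw [div_mul_eq_mul_div, le_div_iff₀ hr0]
      linarith
    have h3 := (h ψ).trans hn
    rw [le_div_iff₀ hr0, hr] at h3
    have h4 : RCLike.re (ψ y) ≤ ‖ψ‖ * ‖y‖ := (RCLike.re_le_norm _).trans (ψ.le_opNorm y)
    have h5 : c * ‖ψ‖ * (1 / c * ‖y‖) = ‖ψ‖ * ‖y‖ := by field_simp
    linarith
  obtain ⟨_, ⟨x, hx, rfl⟩, hd⟩ := Metric.mem_closure_iff.1 hmem (1 / 2 * ‖y‖) (by positivity)
  exact ⟨x, by rw [← dist_eq_norm]; exact hd.le, by simpa using hx⟩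

theorem HasSeparableQuotientIsoTo.of_surjective [CompleteSpace X] [CompleteSpace Y]
    [TopologicalSpace.SeparableSpace Y] (T : X →L[𝕜] Y) (hT : Function.Surjective T) :
    HasSeparableQuotientIsoTo 𝕜 X Y := by
  have hcl : IsClosed (T.ker : Set X) := T.isClosed_ker
  have : IsClosed (T.ker : Set X) := hcl
  let e₀ : (X ⧸ T.ker) ≃ₗ[𝕜] Y := (T : X →ₗ[𝕜] Y).quotKerEquivOfSurjective hT
  have hcont : Continuous e₀ := by
    refine continuous_quot_lift _ T.continuous
  let e : (X ⧸ T.ker) ≃L[𝕜] Y := e₀.toContinuousLinearEquivOfContinuous hcont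
  exact ⟨T.ker, hcl, e.symm.toHomeomorph.isQuotientMap.separableSpace, ⟨e⟩⟩

end Surjectivity

/-! ### The space `c₀` and operators into it. -/

section NullSequences

variable {𝕜 : Type*} [RCLike 𝕜]

namespace CZero

/-- A null sequence as an element of `c₀`. -/
def ofTendsto (a : ℕ → 𝕜) (h : Tendsto a atTop (𝓝 0)) : CZero 𝕜 where
  toFun := a
  continuous_toFun := continuous_of_discreteTopology
  zero_at_infty' := by rwa [cocompact_eq_cofinite, Nat.cofinite_eq_atTop]

@[simp]
theorem ofTendsto_apply (a : ℕ → 𝕜) (h : Tendsto a atTop (𝓝 0)) (n : ℕ) :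
    ofTendsto a h n = a n := rfl

theorem tendsto_zero (a : CZero 𝕜) : Tendsto a atTop (𝓝 0) := by
  have := a.zero_at_infty'
  rwa [cocompact_eq_cofinite, Nat.cofinite_eq_atTop] at this

theorem norm_apply_le (a : CZero 𝕜) (n : ℕ) : ‖a n‖ ≤ ‖a‖ :=
  a.toBCF.norm_coe_le_norm n

theorem norm_le {a : CZero 𝕜} {C : ℝ} (hC : 0 ≤ C) (h : ∀ n, ‖a n‖ ≤ C) : ‖a‖ ≤ C :=
  (BoundedContinuousFunction.norm_le (f := a.toBCF) hC).2 h

variable (𝕜) in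
/-- The coordinate functionals on `c₀`. -/
noncomputable def coord (n : ℕ) : StrongDual 𝕜 (CZero 𝕜) :=
  LinearMap.mkContinuous
    { toFun := fun a => a n, map_add' := fun _ _ => rfl, map_smul' := fun _ _ => rfl } 1
    fun a => by simpa using norm_apply_le a n

@[simp]
theorem coord_apply (n : ℕ) (a : CZero 𝕜) : coord 𝕜 n a = a n := rfl

theorem norm_coord_le (n : ℕ) : ‖coord 𝕜 n‖ ≤ 1 :=
  LinearMap.mkContinuous_norm_le _ zero_le_one _

variable (𝕜) in
/-- The unit vectors of `c₀`. -/
def single (n : ℕ) : CZero 𝕜 :=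
  ofTendsto (Pi.single n 1) <| by
    refine tendsto_const_nhds.congr' ?_
    filter_upwards [eventually_gt_atTop n] with m hm
    simp [hm.ne']

theorem single_apply (n m : ℕ) : single 𝕜 n m = if m = n then 1 else 0 := by
  simp [single, Pi.single_apply]

theorem sum_smul_single_apply (s : Finset ℕ) (a : ℕ → 𝕜) (m : ℕ) :
    (∑ n ∈ s, a n • single 𝕜 n) m = if m ∈ s then a m else 0 := by
  rw [← coord_apply, map_sum]
  simp [single_apply]

theorem tendsto_sum_single (a : CZero 𝕜) :
    Tendsto (fun N => ∑ n ∈ Finset.range N, a n • single 𝕜 n) atTop (𝓝 a) := by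
  rw [Metric.tendsto_atTop]
  intro ε hε
  obtain ⟨N, hN⟩ := Metric.tendsto_atTop.1 a.tendsto_zero (ε / 2) (by positivity)
  refine ⟨N, fun M hM => ?_⟩
  rw [dist_eq_norm]
  refine (norm_le (C := ε / 2) (by positivity) fun m => ?_).trans_lt (by linarith)
  rw [ZeroAtInftyContinuousMap.sub_apply, sum_smul_single_apply]
  split_ifs with hm
  · simpa using (half_pos hε).le
  · have := hN m (hM.trans (by simpa using hm))
    rw [dist_zero_right] at this
    simpa using this.le

instance : TopologicalSpace.SeparableSpace (CZero 𝕜) := by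
  have hs : TopologicalSpace.IsSeparable
      (closure (Submodule.span 𝕜 (Set.range (single 𝕜)) : Set (CZero 𝕜))) :=
    (TopologicalSpace.IsSeparable.span (R := 𝕜) (Set.countable_range _).isSeparable).closure
  refine TopologicalSpace.isSeparable_univ_iff.1 (hs.mono fun a _ => ?_)
  refine mem_closure_of_tendsto a.tendsto_sum_single (Eventually.of_forall fun N => ?_)
  exact Submodule.sum_mem _ fun n _ =>
    Submodule.smul_mem _ _ (Submodule.subset_span ⟨n, rfl⟩)

end CZero

variable {X : Type*} [NormedAddCommGroup X] [NormedSpace 𝕜 X]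

/-- The operator into `c₀` given by a bounded weak* null sequence of functionals. -/
noncomputable def toCZero (g : ℕ → StrongDual 𝕜 X) (C : ℝ) (hC : ∀ n, ‖g n‖ ≤ C)
    (h : ∀ x, Tendsto (fun n => g n x) atTop (𝓝 0)) : X →L[𝕜] CZero 𝕜 :=
  LinearMap.mkContinuous
    { toFun := fun x => CZero.ofTendsto (fun n => g n x) (h x)
      map_add' := fun x y => by ext n; simp
      map_smul' := fun a x => by ext n; simp } C fun x => by
    refine CZero.norm_le (mul_nonneg ((norm_nonneg _).trans (hC 0)) (norm_nonneg x)) fun n => ?_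
    exact ((g n).le_opNorm x).trans (by gcongr; exact hC n)

@[simp]
theorem toCZero_apply (g : ℕ → StrongDual 𝕜 X) (C : ℝ) (hC : ∀ n, ‖g n‖ ≤ C)
    (h : ∀ x, Tendsto (fun n => g n x) atTop (𝓝 0)) (x : X) (n : ℕ) :
    toCZero g C hC h x n = g n x := rfl

/-- Combining unit vectors with unimodular coefficients that rotate each `ψ (single 𝕜 n)` to its
modulus gives a vector of norm at most one. -/
theorem CZero.sum_norm_single_le (ψ : StrongDual 𝕜 (CZero 𝕜)) (s : Finset ℕ) :
    ∑ n ∈ s, ‖ψ (single 𝕜 n)‖ ≤ ‖ψ‖ := by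
  choose θ hθ hθ' using fun n => RCLike.exists_norm_one_mul_eq_norm (ψ (single 𝕜 n))
  have h1 : ψ (∑ n ∈ s, θ n • single 𝕜 n) = ((∑ n ∈ s, ‖ψ (single 𝕜 n)‖ : ℝ) : 𝕜) := by
    simp [map_sum, hθ']
  have h2 : ‖∑ n ∈ s, θ n • single 𝕜 n‖ ≤ 1 := by
    refine norm_le zero_le_one fun m => ?_
    rw [sum_smul_single_apply]
    split_ifs <;> simp [hθ]
  have h3 := ψ.le_of_opNorm_le_of_le le_rfl h2
  rw [h1, RCLike.norm_ofReal, mul_one] at h3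
  exact (le_abs_self _).trans h3

/-- A weak* null sequence in the dual that is equivalent to the unit vector basis of `ℓ₁` induces a
quotient map onto `c₀`. -/
theorem toCZero_surjective [CompleteSpace X] (g : ℕ → StrongDual 𝕜 X) (C : ℝ)
    (hC : ∀ n, ‖g n‖ ≤ C) (h : ∀ x, Tendsto (fun n => g n x) atTop (𝓝 0)) {c : ℝ} (hc : 0 < c)
    (hl : ∀ (a : ℕ → 𝕜) (N : ℕ), c * ∑ n ∈ Finset.range N, ‖a n‖ ≤
      ‖∑ n ∈ Finset.range N, a n • g n‖) : Function.Surjective (toCZero g C hC h) := by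
  refine ContinuousLinearMap.surjective_of_le_norm_comp _ hc fun ψ => ?_
  set T := toCZero g C hC h
  have hsum : Summable fun n => ‖ψ (CZero.single 𝕜 n)‖ :=
    summable_of_sum_range_le (fun n => norm_nonneg _) fun N => CZero.sum_norm_single_le ψ _
  have hsum2 : Summable fun n => ψ (CZero.single 𝕜 n) • g n := by
    refine Summable.of_norm (.of_nonneg_of_le (fun n => norm_nonneg _) (fun n => ?_)
      (hsum.mul_right C))
    rw [norm_smul]
    gcongr
    exact hC n
  have hlim := hsum2.hasSum.tendsto_sum_nat
  -- The adjoint sends `ψ` to a norm convergent combination of the `g n`, so the finite lower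
  -- estimates pass to the limit.
  have heq : ψ.comp T = ∑' n, ψ (CZero.single 𝕜 n) • g n := by
    ext x
    have h1 : Tendsto (fun N => (∑ n ∈ Finset.range N, ψ (CZero.single 𝕜 n) • g n) x) atTop
        (𝓝 ((∑' n, ψ (CZero.single 𝕜 n) • g n) x)) :=
      ((ContinuousLinearMap.apply 𝕜 𝕜 x).continuous.tendsto _).comp hlim
    have h2 : Tendsto (fun N => ψ (∑ n ∈ Finset.range N, T x n • CZero.single 𝕜 n)) atTop
        (𝓝 (ψ (T x))) := (ψ.continuous.tendsto _).comp (T x).tendsto_sum_single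
    refine tendsto_nhds_unique h2 (h1.congr fun N => ?_)
    simp [map_sum, T, mul_comm]
  have hge : ∀ y : CZero 𝕜, c * ‖ψ y‖ ≤ ‖ψ.comp T‖ * ‖y‖ := by
    intro y
    have h1 : Tendsto (fun N => c * ‖ψ (∑ n ∈ Finset.range N, y n • CZero.single 𝕜 n)‖) atTop
        (𝓝 (c * ‖ψ y‖)) :=
      ((ψ.continuous.tendsto _).comp y.tendsto_sum_single).norm.const_mul c
    have h2 : Tendsto (fun N => ‖∑ n ∈ Finset.range N, ψ (CZero.single 𝕜 n) • g n‖ * ‖y‖) atTop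
        (𝓝 (‖ψ.comp T‖ * ‖y‖)) := by
      rw [heq]
      exact hlim.norm.mul_const _
    refine le_of_tendsto_of_tendsto' h1 h2 fun N => ?_
    calc c * ‖ψ (∑ n ∈ Finset.range N, y n • CZero.single 𝕜 n)‖
        ≤ c * ∑ n ∈ Finset.range N, ‖ψ (CZero.single 𝕜 n)‖ * ‖y‖ := by
          gcongr
          rw [map_sum]
          refine norm_sum_le_of_le _ fun n _ => ?_
          rw [map_smul, smul_eq_mul, norm_mul, mul_comm]
          gcongr
          exact y.norm_apply_le n
      _ = (c * ∑ n ∈ Finset.range N, ‖ψ (CZero.single 𝕜 n)‖) * ‖y‖ := by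
          rw [← Finset.sum_mul, mul_assoc]
      _ ≤ _ := by
          gcongr
          exact hl _ N
  have : ‖ψ‖ ≤ ‖ψ.comp T‖ / c := by
    refine ψ.opNorm_le_bound (by positivity) fun y => ?_
    rw [div_mul_eq_mul_div, le_div_iff₀ hc, mul_comm]
    exact hge y
  rwa [le_div_iff₀ hc, mul_comm] at this

end NullSequences

/-! ### Complemented copies of `c₀`. -/

section ComplementedCopies

variable {𝕜 X : Type*} [RCLike 𝕜] [NormedAddCommGroup X] [NormedSpace 𝕜 X]

/-- The isometric embedding of `c₀` into itself that moves the coordinates along an injection. -/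
noncomputable def CZero.spread {m : ℕ → ℕ} (hm : StrictMono m) : CZero 𝕜 →L[𝕜] CZero 𝕜 :=
  LinearMap.mkContinuous
    { toFun := fun a => CZero.ofTendsto (Function.extend m a 0) <| by
        rw [Metric.tendsto_atTop]
        intro ε hε
        obtain ⟨N, hN⟩ := Metric.tendsto_atTop.1 a.tendsto_zero ε hε
        refine ⟨m N, fun k hk => ?_⟩
        by_cases h : ∃ n, m n = k
        · obtain ⟨n, rfl⟩ := h
          rw [hm.injective.extend_apply]
          exact hN n (hm.le_iff_le.1 hk)
        · rw [Function.extend_apply' _ _ _ h]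
          simpa using hε
      map_add' := fun a b => by
        ext k
        by_cases h : ∃ n, m n = k
        · obtain ⟨n, rfl⟩ := h
          simp [hm.injective.extend_apply]
        · simp [Function.extend_apply' _ _ _ h]
      map_smul' := fun c a => by
        ext k
        by_cases h : ∃ n, m n = k
        · obtain ⟨n, rfl⟩ := h
          simp [hm.injective.extend_apply]
        · simp [Function.extend_apply' _ _ _ h] } 1 fun a => by
    refine CZero.norm_le (by positivity) fun k => ?_
    by_cases h : ∃ n, m n = k
    · obtain ⟨n, rfl⟩ := h
      simpa [hm.injective.extend_apply] using a.norm_apply_le n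
    · simp [Function.extend_apply' _ _ _ h]

theorem CZero.spread_apply {m : ℕ → ℕ} (hm : StrictMono m) (a : CZero 𝕜) (n : ℕ) :
    CZero.spread hm a (m n) = a n :=
  hm.injective.extend_apply _ _ _

theorem CZero.spread_apply_of_ne {m : ℕ → ℕ} (hm : StrictMono m) (a : CZero 𝕜) {k : ℕ}
    (hk : ∀ n, m n ≠ k) : CZero.spread hm a k = 0 :=
  Function.extend_apply' _ _ _ (by simpa using hk)

theorem ContainsComplementedCopy.of_leftInverse {Z : Type*} [NormedAddCommGroup Z]
    [NormedSpace 𝕜 Z] (A : Z →L[𝕜] X) (T : X →L[𝕜] Z) (h : Function.LeftInverse T A) :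
    ContainsComplementedCopy 𝕜 X Z := by
  have hc := A.closedComplemented_range_of_leftInverse T h
  refine ⟨A.range, hc.isClosed, hc, ⟨ContinuousLinearEquiv.symm ?_⟩⟩
  exact ContinuousLinearEquiv.equivOfInverse (A.codRestrict A.range fun z => ⟨z, rfl⟩)
    (T.comp A.range.subtypeL) (fun z => h z) (by
      rintro ⟨_, z, rfl⟩
      exact Subtype.ext (congrArg A (h z)))

/-- If the dual ball is weak* sequentially compact, every copy of `c₀` has a complemented
subcopy. -/
theorem ContainsCopy.containsComplementedCopy (hs : IsSeqCompact (dualUnitBall 𝕜 X))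
    (h : ContainsCopy 𝕜 X (CZero 𝕜)) : ContainsComplementedCopy 𝕜 X (CZero 𝕜) := by
  obtain ⟨M, -, ⟨e⟩⟩ := h
  set C : ℝ := ‖(e : M →L[𝕜] CZero 𝕜)‖ + 1 with hC
  have hC0 : 0 < C := by positivity
  have hC' : (C : 𝕜) ≠ 0 := by exact_mod_cast hC0.ne'
  choose f hf hfn using fun n : ℕ =>
    exists_extension_norm_eq M ((CZero.coord 𝕜 n).comp (e : M →L[𝕜] CZero 𝕜))
  have hfC : ∀ n, ‖f n‖ ≤ C := fun n => by
    rw [hfn]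
    refine (ContinuousLinearMap.opNorm_comp_le _ _).trans ?_
    nlinarith [CZero.norm_coord_le (𝕜 := 𝕜) n, norm_nonneg (e : M →L[𝕜] CZero 𝕜),
      norm_nonneg (CZero.coord 𝕜 n)]
  obtain ⟨g, -, φ, hφ, hg⟩ := hs (x := fun n => StrongDual.toWeakDual ((C : 𝕜)⁻¹ • f n)) fun n => by
    simp only [dualUnitBall, Set.mem_preimage, mem_closedBall_zero_iff]
    change ‖(C : 𝕜)⁻¹ • f n‖ ≤ 1
    rw [norm_smul, norm_inv, RCLike.norm_ofReal, abs_of_pos hC0, inv_mul_le_iff₀ hC0, mul_one]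
    exact hfC n
  have hg' : ∀ x, Tendsto (fun n => f (φ n) x) atTop (𝓝 ((C : 𝕜) * g x)) := fun x => by
    refine ((((WeakDual.eval_continuous x).tendsto g).comp hg).const_mul (C : 𝕜)).congr fun n => ?_
    exact mul_inv_cancel_left₀ hC' (f (φ n) x)
  have he : StrictMono fun n : ℕ => φ (2 * n) := fun a b hab => hφ (by lia)
  have h0 : ∀ x, Tendsto (fun n => (f (φ (2 * n)) - f (φ (2 * n + 1))) x) atTop (𝓝 0) := fun x => by
    have h1 := (hg' x).comp (tendsto_atTop_mono (fun n : ℕ => (by lia : n ≤ 2 * n)) tendsto_id)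
    have h2 := (hg' x).comp (tendsto_atTop_mono (fun n : ℕ => (by lia : n ≤ 2 * n + 1)) tendsto_id)
    simpa using h1.sub h2
  -- The basis is spread over the indices `φ (2 * n)` only, so the subtracted functionals `f (φ (2 *
  -- n + 1))` vanish on the image and the composition is the identity.
  refine .of_leftInverse ((M.subtypeL.comp (e.symm : CZero 𝕜 →L[𝕜] M)).comp (CZero.spread he))
    (toCZero (fun n => f (φ (2 * n)) - f (φ (2 * n + 1))) (C + C)
      (fun n => (norm_sub_le _ _).trans (add_le_add (hfC _) (hfC _))) h0) fun a => ?_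
  have hfe : ∀ n b, f n (e.symm b : M) = b n := fun n b => by
    rw [hf]
    simp
  ext n
  simp only [toCZero_apply, ContinuousLinearMap.comp_apply, sub_apply,
    Submodule.subtypeL_apply, ContinuousLinearEquiv.coe_coe, hfe]
  rw [CZero.spread_apply he, CZero.spread_apply_of_ne he, sub_zero]
  intro k hk
  have := hφ.injective hk
  lia

end ComplementedCopies

/-! ### An ultrafilter dichotomy for independent patterns. -/

section Independence

variable {S : Type*} {A : Bool → ℕ → S → Prop} {U : Ultrafilter ℕ}

/-- A finite pattern `L` of conditions `A b n` is unextendable along the ultrafilter `U` if it has no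
common witness, or if for some `b` almost all one-step extensions by `A b n` are unextendable. -/
inductive Unextendable (A : Bool → ℕ → S → Prop) (U : Ultrafilter ℕ) : Finset (Bool × ℕ) → Prop
  | base (L : Finset (Bool × ℕ)) (h : ¬ ∃ x, ∀ p ∈ L, A p.1 p.2 x) : Unextendable A U L
  | step (L : Finset (Bool × ℕ)) (b : Bool) (E : Set ℕ) (hE : E ∈ U)
      (h : ∀ n ∈ E, Unextendable A U (insert (b, n) L)) : Unextendable A U L

/-- A derivation is a well-founded, countably branching tree, and `F` collects the sets `E` used in
it. A point satisfying both conditions infinitely often on `M` could always choose `n ∈ M ∩ E` and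
move to an extended pattern that it still satisfies, until it reached a leaf, which has no witness.
-/
theorem Unextendable.exists_countable {L : Finset (Bool × ℕ)} (hL : Unextendable A U L) :
    ∃ F : Set (Set ℕ), F.Countable ∧ (∀ E ∈ F, E ∈ U) ∧
      ∀ M : Set ℕ, (∀ E ∈ F, (M \ E).Finite) → ∀ x, (∀ p ∈ L, A p.1 p.2 x) →
        ¬ ∀ b, {n ∈ M | A b n x}.Infinite := by
  induction hL with
  | base L h => exact ⟨∅, by simp, by simp, fun M _ x hx => absurd ⟨x, hx⟩ h⟩
  | step L b E hE h ih =>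
    choose! F hF hFU hFM using ih
    refine ⟨insert E (⋃ n ∈ E, F n), ?_, ?_, ?_⟩
    · exact (Set.Countable.biUnion E.to_countable hF).insert E
    · rintro E' (rfl | hE')
      · exact hE
      · obtain ⟨n, hn, hE'⟩ := Set.mem_iUnion₂.1 hE'
        exact hFU n hn E' hE'
    · intro M hM x hx hinf
      have h1 : ({n ∈ M | A b n x} \ (M \ E)).Nonempty :=
        ((hinf b).sdiff (hM E (Set.mem_insert _ _))).nonempty
      obtain ⟨n, ⟨hnM, hnx⟩, hnE⟩ := h1
      have hnE' : n ∈ E := by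
        by_contra h'
        exact hnE ⟨hnM, h'⟩
      refine hFM n hnE' M (fun E' hE' => hM E' ?_) x ?_ hinf
      · exact Set.mem_insert_of_mem _ (Set.mem_iUnion₂.2 ⟨n, hnE', hE'⟩)
      · intro p hp
        rcases Finset.mem_insert.1 hp with rfl | hp
        · exact hnx
        · exact hx p hp

/-- An extendable pattern stays extendable under almost all one-step extensions of either kind. Only
finitely many patterns live on indices up to `m`, so one larger index `n` serves all of them. -/
theorem exists_strictMono_of_not_unextendable (hU : (U : Filter ℕ) ≤ atTop)
    (h : ¬ Unextendable A U ∅) : ∃ φ : ℕ → ℕ, StrictMono φ ∧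
      ∀ (N : ℕ) (σ : ℕ → Bool), ∃ x, ∀ k < N, A (σ k) (φ k) x := by
  have hstep : ∀ m : ℕ, ∃ n, m < n ∧
      ∀ L ∈ (Finset.univ ×ˢ Finset.range (m + 1) : Finset (Bool × ℕ)).powerset,
        ¬ Unextendable A U L → ∀ b, ¬ Unextendable A U (insert (b, n) L) := by
    intro m
    have h1 : ∀ᶠ n in (U : Filter ℕ), m < n := hU (eventually_gt_atTop m)
    have h2 : ∀ᶠ n in (U : Filter ℕ),
        ∀ L ∈ (Finset.univ ×ˢ Finset.range (m + 1) : Finset (Bool × ℕ)).powerset,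
          ¬ Unextendable A U L → ∀ b, ¬ Unextendable A U (insert (b, n) L) := by
      refine (eventually_all_finset _).2 fun L _ => ?_
      by_cases hL : Unextendable A U L
      · exact Eventually.of_forall fun n hn => absurd hL hn
      · have : ∀ b, ∀ᶠ n in (U : Filter ℕ), ¬ Unextendable A U (insert (b, n) L) := by
          intro b
          refine Ultrafilter.eventually_not.2 fun hb => hL ?_
          exact .step L b _ hb fun n hn => hn
        filter_upwards [eventually_all.2 this] with n hn _ b using hn b
    exact (h1.and h2).exists
  choose s hs hsL using hstep
  have hmono : StrictMono fun k => s^[k] (s 0) :=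
    strictMono_nat_of_lt_succ fun k => by
      rw [Function.iterate_succ_apply']
      exact hs _
  refine ⟨_, hmono, fun N σ => ?_⟩
  set φ : ℕ → ℕ := fun k => s^[k] (s 0)
  have hne : ∀ N, ¬ Unextendable A U ((Finset.range N).image fun k => (σ k, φ k)) := by
    intro N
    induction N with
    | zero => simpa using h
    | succ N ih =>
      rw [Finset.range_add_one, Finset.image_insert]
      rcases N with _ | N
      · refine hsL 0 _ ?_ ih _
        simp
      · have : φ (N + 1) = s (φ N) := Function.iterate_succ_apply' _ _ _
        rw [this]
        refine hsL (φ N) _ ?_ ih _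
        rw [Finset.mem_powerset]
        intro p hp
        obtain ⟨k, hk, rfl⟩ := Finset.mem_image.1 hp
        have := hmono.monotone (Nat.lt_succ_iff.1 (Finset.mem_range.1 hk))
        simpa [Nat.lt_succ_iff] using this
  by_contra hx
  refine hne N (.base _ fun ⟨x, hx'⟩ => hx ⟨x, fun k hk => ?_⟩)
  exact hx' _ (Finset.mem_image_of_mem _ (Finset.mem_range.2 hk))

/-- Finite intersections of members of the ultrafilter are infinite, so a countable family of
members has an infinite pseudo-intersection. -/
theorem exists_strictMono_range_diff_finite (hU : (U : Filter ℕ) ≤ atTop) {F : Set (Set ℕ)}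
    (hF : F.Countable) (hFU : ∀ E ∈ F, E ∈ U) :
    ∃ ψ : ℕ → ℕ, StrictMono ψ ∧ ∀ E ∈ F, (Set.range ψ \ E).Finite := by
  rcases F.eq_empty_or_nonempty with rfl | hne
  · exact ⟨id, strictMono_id, by simp⟩
  obtain ⟨e, rfl⟩ := hF.exists_eq_range hne
  obtain ⟨ψ, hψ, h⟩ := extraction_forall_of_frequently (P := fun n k => ∀ i ≤ n, k ∈ e i) <| by
    intro n
    have : ∀ᶠ k in (U : Filter ℕ), ∀ i ≤ n, k ∈ e i :=
      (eventually_all_finite (Set.finite_Iic n)).2 fun i _ => hFU _ ⟨i, rfl⟩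
    exact this.frequently.filter_mono hU
  refine ⟨ψ, hψ, ?_⟩
  rintro _ ⟨i, rfl⟩
  refine ((Set.finite_Iio i).image ψ).subset ?_
  rintro _ ⟨⟨n, rfl⟩, hn⟩
  refine ⟨n, ?_, rfl⟩
  by_contra hi
  exact hn (h n i (not_lt.1 hi))

end Independence

/-! ### Rosenthal's dichotomy and lower `ℓ₁` estimates. -/

section Rosenthal

variable {𝕜 X : Type*} [RCLike 𝕜] [NormedAddCommGroup X] [NormedSpace 𝕜 X]

theorem exists_two_mapClusterPt {u : ℕ → 𝕜} {r : ℝ} (hu : ∀ n, ‖u n‖ ≤ r)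
    (h : ¬ ∃ z, Tendsto u atTop (𝓝 z)) :
    ∃ α β, α ≠ β ∧ MapClusterPt α atTop u ∧ MapClusterPt β atTop u := by
  have hK : IsCompact (Metric.closedBall (0 : 𝕜) r) := isCompact_closedBall _ _
  have hmem : ∀ᶠ n in atTop, u n ∈ Metric.closedBall (0 : 𝕜) r :=
    Eventually.of_forall fun n => by simpa using hu n
  obtain ⟨α, -, hα⟩ := hK.exists_mapClusterPt (f := atTop) (u := u) (by simpa using hmem)
  by_contra hcon
  push Not at hcon
  refine h ⟨α, hK.tendsto_nhds_of_unique_mapClusterPt hmem fun β _ hβ => ?_⟩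
  by_contra hne
  exact hcon α β (Ne.symm hne) hα hβ

/-- A form of Rosenthal's theorem: a bounded sequence of functionals without pointwise convergent
subsequence has a subsequence that takes, up to a small error, two distinct values independently on
the unit ball. -/
theorem exists_independent_subsequence (f : ℕ → StrongDual 𝕜 X) (hf : ∀ n, ‖f n‖ ≤ 1)
    (h : ∀ ψ : ℕ → ℕ, StrictMono ψ → ∃ x, ¬ ∃ z, Tendsto (fun n => f (ψ n) x) atTop (𝓝 z)) :
    ∃ (α β : 𝕜) (ρ : ℝ) (φ : ℕ → ℕ), 0 < ρ ∧ 16 * ρ ≤ ‖α - β‖ ∧ StrictMono φ ∧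
      ∀ (N : ℕ) (σ : ℕ → Bool), ∃ x, ‖x‖ ≤ 1 ∧
        ∀ k < N, ‖f (φ k) x - (if σ k then α else β)‖ ≤ ρ := by
  let d : ℕ → 𝕜 := TopologicalSpace.denseSeq 𝕜
  -- Values from a dense sequence and tolerances `1 / (l + 1)` leave only countably many cases, so
  -- that a single subsequence can handle all the families `F j` below.
  let J : Set (ℕ × ℕ × ℕ) := {j | 16 * (1 / ((j.2.2 : ℝ) + 1)) ≤ ‖d j.1 - d j.2.1‖}
  let A : ℕ × ℕ × ℕ → Bool → ℕ → {x : X // ‖x‖ ≤ 1} → Prop := fun j b n x =>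
    ‖f n x - (if b then d j.1 else d j.2.1)‖ ≤ 1 / ((j.2.2 : ℝ) + 1)
  let U : Ultrafilter ℕ := hyperfilter ℕ
  have hU : (U : Filter ℕ) ≤ atTop := Nat.hyperfilter_le_atTop
  by_cases hJ : ∃ j ∈ J, ¬ Unextendable (A j) U ∅
  · obtain ⟨j, hj, hbad⟩ := hJ
    obtain ⟨φ, hφ, hx⟩ := exists_strictMono_of_not_unextendable hU hbad
    refine ⟨d j.1, d j.2.1, 1 / ((j.2.2 : ℝ) + 1), φ, by positivity, hj, hφ, fun N σ => ?_⟩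
    obtain ⟨x, hx⟩ := hx N σ
    exact ⟨x, x.2, hx⟩
  exfalso
  push Not at hJ
  choose! F hF hFU hFM using fun j hj => (hJ j hj).exists_countable
  obtain ⟨ψ, hψ, hψF⟩ := exists_strictMono_range_diff_finite hU (F := ⋃ j ∈ J, F j)
    (Set.Countable.biUnion J.to_countable hF) (by
      intro E hE
      obtain ⟨j, hj, hE⟩ := Set.mem_iUnion₂.1 hE
      exact hFU j hj E hE)
  obtain ⟨x₀, hx₀⟩ := h ψ hψ
  obtain ⟨x, hx, hxn⟩ : ∃ x : X, ‖x‖ ≤ 1 ∧ ¬ ∃ z, Tendsto (fun n => f (ψ n) x) atTop (𝓝 z) := by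
    have hr : (0 : ℝ) < ‖x₀‖ + 1 := by positivity
    have hr' : ((‖x₀‖ + 1 : ℝ) : 𝕜) ≠ 0 := by exact_mod_cast hr.ne'
    refine ⟨((‖x₀‖ + 1 : ℝ) : 𝕜)⁻¹ • x₀, ?_, ?_⟩
    · rw [norm_smul, norm_inv, RCLike.norm_ofReal, abs_of_pos hr, inv_mul_le_iff₀ hr]
      linarith
    · rintro ⟨z, hz⟩
      refine hx₀ ⟨((‖x₀‖ + 1 : ℝ) : 𝕜) * z, (hz.const_mul _).congr fun n => ?_⟩
      rw [map_smul, smul_eq_mul, mul_inv_cancel_left₀ hr']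
  obtain ⟨α, β, hne, hα, hβ⟩ := exists_two_mapClusterPt (r := 1)
    (fun n => ((f (ψ n)).le_of_opNorm_le_of_le (hf _) hx).trans (by norm_num)) hxn
  have hpos : 0 < ‖α - β‖ := norm_pos_iff.2 (sub_ne_zero.2 hne)
  -- Since `32 * ρ < ‖α - β‖`, replacing `α` and `β` by dense values within `ρ / 2` leaves a gap
  -- above `31 * ρ`, more than the required `16 * ρ`.
  obtain ⟨l, hl⟩ := exists_nat_one_div_lt (show 0 < ‖α - β‖ / 32 by positivity)
  have hl0 : (0 : ℝ) < 1 / ((l : ℝ) + 1) := by positivity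
  set ρ : ℝ := 1 / ((l : ℝ) + 1) with hρ
  have hdense : ∀ z : 𝕜, ∃ i, dist z (d i) < ρ / 2 := fun z =>
    (TopologicalSpace.denseRange_denseSeq 𝕜).exists_dist_lt z (by positivity)
  obtain ⟨i₁, hi₁⟩ := hdense α
  obtain ⟨i₂, hi₂⟩ := hdense β
  have hj : (i₁, i₂, l) ∈ J := by
    change 16 * ρ ≤ ‖d i₁ - d i₂‖
    have h1 : dist α β ≤ dist α (d i₁) + dist (d i₁) (d i₂) + dist (d i₂) β :=
      dist_triangle4 _ _ _ _
    rw [dist_comm (d i₂) β, dist_eq_norm α β, dist_eq_norm (d i₁)] at h1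
    linarith
  have hinf : ∀ (z : 𝕜) (i : ℕ), dist z (d i) < ρ / 2 →
      MapClusterPt z atTop (fun n => f (ψ n) x) →
      {n ∈ Set.range ψ | ‖f n x - d i‖ ≤ ρ}.Infinite := by
    intro z i hi hz
    have h1 : ∃ᶠ n in atTop, f (ψ n) x ∈ Metric.ball z (ρ / 2) :=
      hz.frequently (Metric.ball_mem_nhds z (by positivity))
    refine ((Nat.frequently_atTop_iff_infinite.1 h1).image hψ.injective.injOn).mono ?_
    rintro _ ⟨n, hn, rfl⟩
    refine ⟨⟨n, rfl⟩, ?_⟩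
    rw [← dist_eq_norm]
    have := dist_triangle (f (ψ n) x) z (d i)
    have hn' : dist (f (ψ n) x) z < ρ / 2 := hn
    linarith
  refine hFM _ hj (Set.range ψ) (fun E hE => hψF E (Set.mem_iUnion₂.2 ⟨_, hj, hE⟩)) ⟨x, hx⟩
    (by simp) fun b => ?_
  cases b
  · exact hinf β i₂ hi₂ hβ
  · exact hinf α i₁ hi₁ hα

theorem RCLike.sum_norm_le_sum_abs_re {ι : Type*} (s : Finset ι) (a : ι → 𝕜) :
    ∑ k ∈ s, ‖a k‖ ≤ ∑ k ∈ s, |RCLike.re (1 * a k)| + ∑ k ∈ s, |RCLike.re (RCLike.I * a k)| := by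
  rw [← Finset.sum_add_distrib]
  refine Finset.sum_le_sum fun k _ => ?_
  rw [one_mul, RCLike.I_mul_re, abs_neg]
  refine abs_le_of_sq_le_sq' ?_ (by positivity) |>.2
  rw [RCLike.norm_sq_eq_def, add_sq, sq_abs, sq_abs]
  nlinarith [abs_nonneg (RCLike.re (a k)), abs_nonneg (RCLike.im (a k)),
    mul_nonneg (abs_nonneg (RCLike.re (a k))) (abs_nonneg (RCLike.im (a k)))]

/-- Functionals that take two distinct values independently satisfy a lower `ℓ₁` estimate. -/
theorem le_norm_sum_of_independent {f : ℕ → StrongDual 𝕜 X} {α β : 𝕜} {ρ : ℝ}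
    (hρ : 16 * ρ ≤ ‖α - β‖) (N : ℕ)
    (h : ∀ σ : ℕ → Bool, ∃ x, ‖x‖ ≤ 1 ∧ ∀ k < N, ‖f k x - (if σ k then α else β)‖ ≤ ρ)
    (a : ℕ → 𝕜) :
    ‖α - β‖ / 8 * ∑ k ∈ Finset.range N, ‖a k‖ ≤ ‖∑ k ∈ Finset.range N, a k • f k‖ := by
  set F := ∑ k ∈ Finset.range N, a k • f k
  obtain ⟨θ, hθ, hθd⟩ := RCLike.exists_norm_one_mul_eq_norm (α - β)
  have key : ∀ ω : 𝕜, ‖ω‖ ≤ 1 → ‖α - β‖ * ∑ k ∈ Finset.range N, |RCLike.re (ω * a k)| -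
      2 * ρ * ∑ k ∈ Finset.range N, ‖a k‖ ≤ 2 * ‖F‖ := by
    intro ω hω
    -- Opposite patterns make `f k x - f k y` close to `±(α - β)`, with the sign of `re (ω * a k)`;
    -- the factor `θ` rotates `α - β` to the positive axis.
    obtain ⟨x, hx, hxk⟩ := h fun k => decide (0 ≤ RCLike.re (ω * a k))
    obtain ⟨y, hy, hyk⟩ := h fun k => !decide (0 ≤ RCLike.re (ω * a k))
    have hz : ‖θ • (x - y)‖ ≤ 2 := by
      rw [norm_smul, hθ, one_mul]
      exact (norm_sub_le _ _).trans (by linarith)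
    have h1 : RCLike.re (ω * F (θ • (x - y))) ≤ 2 * ‖F‖ := by
      refine (RCLike.re_le_norm _).trans ?_
      rw [norm_mul]
      have := F.le_of_opNorm_le_of_le le_rfl hz
      nlinarith [norm_nonneg (F (θ • (x - y))), norm_nonneg ω]
    refine le_trans ?_ h1
    have h2 : ω * F (θ • (x - y)) = ∑ k ∈ Finset.range N, ω * a k * (θ * (f k x - f k y)) := by
      simp only [F, sum_apply, smul_apply, map_smul, map_sub, smul_eq_mul]
      rw [← Finset.sum_sub_distrib, Finset.mul_sum, Finset.mul_sum]
      exact Finset.sum_congr rfl fun k _ => by ring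
    rw [h2, map_sum, Finset.mul_sum, Finset.mul_sum, ← Finset.sum_sub_distrib]
    refine Finset.sum_le_sum fun k hk => ?_
    have hk' := Finset.mem_range.1 hk
    have e1 := hxk k hk'
    have e2 := hyk k hk'
    set s : ℝ := if 0 ≤ RCLike.re (ω * a k) then 1 else -1 with hs
    have hse : (s : 𝕜) * (α - β) =
        (if decide (0 ≤ RCLike.re (ω * a k)) then α else β) -
          (if !decide (0 ≤ RCLike.re (ω * a k)) then α else β) := by
      by_cases h0 : 0 ≤ RCLike.re (ω * a k)
      · simp only [hs, h0]
        simp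
      · simp only [hs, h0]
        simp
    have hsabs : s * RCLike.re (ω * a k) = |RCLike.re (ω * a k)| := by
      by_cases h0 : 0 ≤ RCLike.re (ω * a k)
      · rw [hs, if_pos h0, abs_of_nonneg h0, one_mul]
      · simp only [hs, h0, if_false, abs_of_neg (not_le.1 h0)]
        ring
    have herr : ‖θ * (f k x - f k y) - ((s * ‖α - β‖ : ℝ) : 𝕜)‖ ≤ 2 * ρ := by
      have : θ * (f k x - f k y) - ((s * ‖α - β‖ : ℝ) : 𝕜) =
          θ * ((f k x - (if decide (0 ≤ RCLike.re (ω * a k)) then α else β)) -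
            (f k y - (if !decide (0 ≤ RCLike.re (ω * a k)) then α else β))) := by
        rw [RCLike.ofReal_mul, ← hθd, sub_sub_sub_comm, ← hse]
        ring
      rw [this, norm_mul, hθ, one_mul]
      exact (norm_sub_le _ _).trans (by linarith)
    have h3 : ω * a k * (θ * (f k x - f k y)) = ω * a k * ((s * ‖α - β‖ : ℝ) : 𝕜) +
        ω * a k * (θ * (f k x - f k y) - ((s * ‖α - β‖ : ℝ) : 𝕜)) := by ring
    have h4 : ‖ω * a k * (θ * (f k x - f k y) - ((s * ‖α - β‖ : ℝ) : 𝕜))‖ ≤ ‖a k‖ * (2 * ρ) := by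
      rw [norm_mul, norm_mul]
      have : ‖ω‖ * ‖a k‖ ≤ ‖a k‖ := mul_le_of_le_one_left (norm_nonneg _) hω
      gcongr
    have h5 := (abs_le.1 (RCLike.abs_re_le_norm
      (ω * a k * (θ * (f k x - f k y) - ((s * ‖α - β‖ : ℝ) : 𝕜))))).1
    rw [h3, map_add, RCLike.re_mul_ofReal]
    have h6 : RCLike.re (ω * a k) * (s * ‖α - β‖) = ‖α - β‖ * |RCLike.re (ω * a k)| := by
      rw [← hsabs]; ring
    linarith
  -- The cases `ω = 1` and `ω = I` recover the moduli: their sum gives `(‖α - β‖ - 4 * ρ) * ∑ ‖a k‖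
  -- ≤ 4 * ‖F‖`, and `4 * ρ ≤ ‖α - β‖ / 4`.
  have k1 := key 1 (by simp)
  have k2 := key RCLike.I (by rw [RCLike.norm_I]; split_ifs <;> norm_num)
  have k3 := mul_le_mul_of_nonneg_left (RCLike.sum_norm_le_sum_abs_re (Finset.range N) a)
    (norm_nonneg (α - β))
  rw [mul_add] at k3
  have k4 : 0 ≤ ∑ k ∈ Finset.range N, ‖a k‖ := Finset.sum_nonneg fun _ _ => norm_nonneg _
  have k5 := mul_le_mul_of_nonneg_right hρ k4
  have k6 := mul_nonneg (norm_nonneg (α - β)) k4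
  linarith

end Rosenthal

/-! ### Block sequences with stable tail size. -/

section Blocks

variable {𝕜 : Type*} [RCLike 𝕜]

/-- The `ℓ₁` norm of a finitely supported sequence. -/
def l1Norm (w : ℕ →₀ 𝕜) : ℝ := w.sum fun _ a => ‖a‖

@[simp]
theorem l1Norm_single (n : ℕ) (a : 𝕜) : l1Norm (Finsupp.single n a) = ‖a‖ :=
  Finsupp.sum_single_index norm_zero

theorem l1Norm_smul (c : 𝕜) (w : ℕ →₀ 𝕜) : l1Norm (c • w) = ‖c‖ * l1Norm w := by
  rw [l1Norm, Finsupp.sum_smul_index' (fun _ => norm_zero), l1Norm, Finsupp.mul_sum]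
  simp

theorem l1Norm_sum {ι : Type*} (s : Finset ι) (w : ι → ℕ →₀ 𝕜)
    (h : (s : Set ι).Pairwise fun i j => Disjoint (w i).support (w j).support) :
    l1Norm (∑ i ∈ s, w i) = ∑ i ∈ s, l1Norm (w i) := by
  classical
  induction s using Finset.induction_on with
  | empty => simp [l1Norm]
  | insert a s ha ih =>
    rw [Finset.sum_insert ha, Finset.sum_insert ha]
    rw [Finset.coe_insert] at h
    rw [← ih (h.mono (Set.subset_insert _ _))]
    refine Finsupp.sum_add_index_of_disjoint ?_ _
    refine Disjoint.mono_right (Finsupp.support_finsetSum) ?_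
    rw [Finset.disjoint_biUnion_right]
    intro i hi
    exact h (Set.mem_insert _ _) (Set.mem_insert_of_mem _ hi) (by rintro rfl; exact ha hi)

/-- A sequence of disjointly supported unit vectors of `ℓ₁`. -/
structure IsBlockSeq (u : ℕ → ℕ →₀ 𝕜) : Prop where
  norm_eq : ∀ n, l1Norm (u n) = 1
  disjoint : Pairwise fun m n => Disjoint (u m).support (u n).support

/-- The vector `w` lies in the absolutely convex hull of `u k, u (k + 1), …`, in terms of
seminorms. -/
def InTailHull (u : ℕ → ℕ →₀ 𝕜) (k : ℕ) (w : ℕ →₀ 𝕜) : Prop :=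
  ∀ (p : Seminorm 𝕜 (ℕ →₀ 𝕜)) (t : ℝ), (∀ i ≥ k, p (u i) ≤ t) → p w ≤ t

/-- The terms of `v` eventually lie in the absolutely convex hull of every tail of `u`. -/
def Refines (v u : ℕ → ℕ →₀ 𝕜) : Prop :=
  ∀ k, ∀ᶠ n in atTop, InTailHull u k (v n)

theorem InTailHull.of_le {u : ℕ → ℕ →₀ 𝕜} {k n : ℕ} (h : k ≤ n) : InTailHull u k (u n) :=
  fun _ _ hp => hp n h

theorem InTailHull.trans {u v : ℕ → ℕ →₀ 𝕜} {k K : ℕ} {w : ℕ →₀ 𝕜}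
    (h : ∀ i ≥ K, InTailHull u k (v i)) (hw : InTailHull v K w) : InTailHull u k w :=
  fun p t hp => hw p t fun i hi => h i hi p t hp

theorem InTailHull.mono {u : ℕ → ℕ →₀ 𝕜} {k K : ℕ} {w : ℕ →₀ 𝕜} (h : k ≤ K)
    (hw : InTailHull u K w) : InTailHull u k w :=
  fun p t hp => hw p t fun i hi => hp i (h.trans hi)

theorem Refines.refl (u : ℕ → ℕ →₀ 𝕜) : Refines u u :=
  fun k => (eventually_ge_atTop k).mono fun _ h => .of_le h

theorem Refines.trans {u v w : ℕ → ℕ →₀ 𝕜} (h₁ : Refines w v) (h₂ : Refines v u) :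
    Refines w u := fun k => by
  obtain ⟨K, hK⟩ := eventually_atTop.1 (h₂ k)
  exact (h₁ K).mono fun n hn => .trans hK hn

theorem IsBlockSeq.eventually_disjoint {u : ℕ → ℕ →₀ 𝕜} (hu : IsBlockSeq u) (B : Finset ℕ) :
    ∀ᶠ m in atTop, Disjoint B (u m).support := by
  have : ∀ b ∈ B, ∀ᶠ m in atTop, b ∉ (u m).support := by
    intro b _
    by_cases h : ∃ m, b ∈ (u m).support
    · obtain ⟨m, hm⟩ := h
      filter_upwards [eventually_gt_atTop m] with n hn hbn
      exact Finset.disjoint_left.1 (hu.disjoint hn.ne) hm hbn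
    · push Not at h
      exact Eventually.of_forall h
  filter_upwards [(eventually_all_finset B).2 this] with m hm
  exact Finset.disjoint_left.2 hm

/-- Terms are picked far out in `u n` for increasing levels `n`, beyond all earlier supports and
inside the tail hulls of `u 0, …, u n`. The level is recorded with the vector so that it can be
forced to increase. -/
theorem IsBlockSeq.exists_diagonal {u : ℕ → ℕ → ℕ →₀ 𝕜} (hu : ∀ j, IsBlockSeq (u j))
    (hr : ∀ j, Refines (u (j + 1)) (u j)) : ∃ w, IsBlockSeq w ∧ ∀ j, Refines w (u j) := by
  classical
  have hr' : ∀ j n, j ≤ n → Refines (u n) (u j) := fun j n hjn => by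
    induction n, hjn using Nat.le_induction with
    | base => exact .refl _
    | succ n _ ih => exact (hr n).trans ih
  obtain ⟨f, hP, hf⟩ := exists_seq_of_forall_finset_exists
    (fun q : ℕ × (ℕ →₀ 𝕜) => l1Norm q.2 = 1 ∧ ∀ j ≤ q.1, InTailHull (u j) q.1 q.2)
    (fun q q' => q.1 < q'.1 ∧ Disjoint q.2.support q'.2.support) <| by
      intro s _
      let n := s.sup Prod.fst + 1
      let B := s.biUnion fun q => q.2.support
      have h1 : ∀ᶠ m in atTop, ∀ j ≤ n, InTailHull (u j) n (u n m) :=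
        (eventually_all_finite (Set.finite_Iic n)).2 fun j hj => hr' j n hj n
      obtain ⟨m, hm1, hm2⟩ := (h1.and ((hu n).eventually_disjoint B)).exists
      refine ⟨(n, u n m), ⟨(hu n).norm_eq m, hm1⟩, fun q hq => ⟨?_, ?_⟩⟩
      · exact Nat.lt_succ_of_le (Finset.le_sup (f := Prod.fst) hq)
      · exact (Finset.disjoint_biUnion_left _ _ _).1 hm2 q hq
  have hmono : StrictMono fun n => (f n).1 := fun m n hmn => (hf m n hmn).1
  refine ⟨fun n => (f n).2, ⟨fun n => (hP n).1, fun m n hmn => ?_⟩, fun j k => ?_⟩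
  · rcases hmn.lt_or_gt with h | h
    · exact (hf m n h).2
    · exact (hf n m h).2.symm
  · filter_upwards [eventually_ge_atTop (max j k)] with n hn
    have hn' := hmono.le_apply (x := n)
    exact ((hP n).2 j (by lia)).mono (by lia)

variable {X : Type*} [NormedAddCommGroup X] [NormedSpace 𝕜 X] (g : ℕ → StrongDual 𝕜 X)

theorem norm_linearCombination_le (hg : ∀ n, ‖g n‖ ≤ 1) (w : ℕ →₀ 𝕜) :
    ‖Finsupp.linearCombination 𝕜 g w‖ ≤ l1Norm w := by
  rw [Finsupp.linearCombination_apply, l1Norm, Finsupp.sum, Finsupp.sum]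
  refine norm_sum_le_of_le _ fun i _ => ?_
  rw [norm_smul]
  exact mul_le_of_le_one_right (norm_nonneg _) (hg i)

/-- The eventual pointwise bounds on the unit ball for the functionals with coefficients `u n`. -/
def tailBounds (u : ℕ → ℕ →₀ 𝕜) : Set ℝ :=
  {t | 0 ≤ t ∧ ∀ x : X, ‖x‖ ≤ 1 →
    ∀ᶠ n in atTop, ‖Finsupp.linearCombination 𝕜 g (u n) x‖ ≤ t}

/-- The supremum over the unit ball of the upper limits of the functionals with coefficients
`u n`. -/
noncomputable def tailSize (u : ℕ → ℕ →₀ 𝕜) : ℝ := sInf (tailBounds g u)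

variable {g}

/-- For fixed `x`, the modulus of the evaluation at `x` is a seminorm in the coefficients, so a
bound on a tail of `u` passes to its absolutely convex hull. -/
theorem Refines.tailBounds_subset {u v : ℕ → ℕ →₀ 𝕜} (h : Refines v u) :
    tailBounds g u ⊆ tailBounds g v := by
  rintro t ⟨ht, hx⟩
  refine ⟨ht, fun x hx1 => ?_⟩
  obtain ⟨k, hk⟩ := eventually_atTop.1 (hx x hx1)
  let p : Seminorm 𝕜 (ℕ →₀ 𝕜) := (normSeminorm 𝕜 𝕜).comp
    ((ContinuousLinearMap.apply 𝕜 𝕜 x : StrongDual 𝕜 X →ₗ[𝕜] 𝕜) ∘ₗ Finsupp.linearCombination 𝕜 g)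
  exact (h k).mono fun n hn => hn p t hk

theorem IsBlockSeq.one_mem_tailBounds (hg : ∀ n, ‖g n‖ ≤ 1) {u : ℕ → ℕ →₀ 𝕜} (hu : IsBlockSeq u) :
    1 ∈ tailBounds g u := by
  refine ⟨zero_le_one, fun x hx => Eventually.of_forall fun n => ?_⟩
  have h1 := norm_linearCombination_le g hg (u n)
  rw [hu.norm_eq] at h1
  exact (ContinuousLinearMap.le_of_opNorm_le_of_le _ h1 hx).trans (by norm_num)

theorem bddBelow_tailBounds (u : ℕ → ℕ →₀ 𝕜) : BddBelow (tailBounds g u) :=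
  ⟨0, fun _ h => h.1⟩

theorem tailSize_nonneg (u : ℕ → ℕ →₀ 𝕜) : 0 ≤ tailSize g u :=
  Real.sInf_nonneg fun _ h => h.1

theorem Refines.tailSize_le (hg : ∀ n, ‖g n‖ ≤ 1) {u v : ℕ → ℕ →₀ 𝕜} (hu : IsBlockSeq u)
    (h : Refines v u) : tailSize g v ≤ tailSize g u :=
  csInf_le_csInf (bddBelow_tailBounds v) ⟨1, hu.one_mem_tailBounds hg⟩ h.tailBounds_subset

theorem IsBlockSeq.eventually_norm_le (hg : ∀ n, ‖g n‖ ≤ 1) {u : ℕ → ℕ →₀ 𝕜} (hu : IsBlockSeq u)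
    {t : ℝ} (ht : tailSize g u < t) {x : X} (hx : ‖x‖ ≤ 1) :
    ∀ᶠ n in atTop, ‖Finsupp.linearCombination 𝕜 g (u n) x‖ ≤ t := by
  obtain ⟨s, hs, hst⟩ := exists_lt_of_csInf_lt ⟨1, hu.one_mem_tailBounds hg⟩ ht
  exact (hs.2 x hx).mono fun n hn => hn.trans hst.le

theorem exists_frequently_lt_norm {u : ℕ → ℕ →₀ 𝕜} {t : ℝ} (ht0 : 0 ≤ t) (ht : t < tailSize g u) :
    ∃ x : X, ‖x‖ ≤ 1 ∧ ∃ᶠ n in atTop, t < ‖Finsupp.linearCombination 𝕜 g (u n) x‖ := by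
  have : t ∉ tailBounds g u := fun h => ht.not_ge (csInf_le (bddBelow_tailBounds u) h)
  by_contra hcon
  push Not at hcon
  exact this ⟨ht0, fun x hx => by simpa using hcon x hx⟩

theorem isBlockSeq_single : IsBlockSeq fun n => Finsupp.single n (1 : 𝕜) where
  norm_eq n := by simp
  disjoint m n hmn := by
    simp [hmn]

/-- Block sequences whose tail size cannot be decreased by passing to further block sequences. -/
theorem exists_stable_isBlockSeq (hg : ∀ n, ‖g n‖ ≤ 1) :
    ∃ w : ℕ → ℕ →₀ 𝕜, IsBlockSeq w ∧
      ∀ v, IsBlockSeq v → Refines v w → tailSize g v = tailSize g w := by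
  -- Each step nearly minimises the tail size among all refinements, with error `1 / (j + 1)`; a
  -- sequence refining every step then attains the minimum among its own refinements.
  have step : ∀ (j : ℕ) (u : {u : ℕ → ℕ →₀ 𝕜 // IsBlockSeq u}),
      ∃ v : {u : ℕ → ℕ →₀ 𝕜 // IsBlockSeq u}, Refines v.1 u.1 ∧ ∀ v', IsBlockSeq v' →
        Refines v' u.1 → tailSize g v.1 ≤ tailSize g v' + 1 / ((j : ℝ) + 1) := by
    intro j u
    let S : Set ℝ := {s | ∃ v, IsBlockSeq v ∧ Refines v u.1 ∧ tailSize g v = s}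
    have hS : BddBelow S := ⟨0, by rintro _ ⟨v, -, -, rfl⟩; exact tailSize_nonneg v⟩
    obtain ⟨_, ⟨v, hv, hvu, rfl⟩, hlt⟩ := Real.lt_sInf_add_pos (s := S)
      ⟨_, u.1, u.2, .refl _, rfl⟩ (ε := 1 / ((j : ℝ) + 1)) (by positivity)
    refine ⟨⟨v, hv⟩, hvu, fun v' hv' hv'u => hlt.le.trans ?_⟩
    gcongr
    exact csInf_le hS ⟨v', hv', hv'u, rfl⟩
  choose nxt hn1 hn2 using step
  let f : ℕ → {u : ℕ → ℕ →₀ 𝕜 // IsBlockSeq u} :=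
    fun n => Nat.rec ⟨_, isBlockSeq_single⟩ (fun j u => nxt j u) n
  obtain ⟨w, hw, hwf⟩ := IsBlockSeq.exists_diagonal (fun j => (f j).2)
    (fun j => hn1 j (f j))
  refine ⟨w, hw, fun v hv hvw => le_antisymm (hvw.tailSize_le hg hw) ?_⟩
  refine le_of_forall_pos_le_add fun ε hε => ?_
  obtain ⟨j, hj⟩ := exists_nat_one_div_lt hε
  calc tailSize g w ≤ tailSize g (f (j + 1)).1 := (hwf (j + 1)).tailSize_le hg (f (j + 1)).2
    _ ≤ tailSize g v + 1 / ((j : ℝ) + 1) := hn2 j (f j) v hv (hvw.trans (hwf j))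
    _ ≤ tailSize g v + ε := by linarith

/-- If a block sequence of an `ℓ₁`-sequence of functionals has tail size zero, then `c₀` is a
quotient. -/
theorem hasSeparableQuotientIsoTo_cZero_of_tailSize_eq_zero [CompleteSpace X]
    (hg : ∀ n, ‖g n‖ ≤ 1) {c : ℝ} (hc : 0 < c)
    (hl : ∀ w : ℕ →₀ 𝕜, c * l1Norm w ≤ ‖Finsupp.linearCombination 𝕜 g w‖)
    {u : ℕ → ℕ →₀ 𝕜} (hu : IsBlockSeq u) (h0 : tailSize g u = 0) :
    HasSeparableQuotientIsoTo 𝕜 X (CZero 𝕜) := by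
  have hC : ∀ n, ‖Finsupp.linearCombination 𝕜 g (u n)‖ ≤ 1 := fun n =>
    (norm_linearCombination_le g hg (u n)).trans (hu.norm_eq n).le
  have hball : ∀ x : X, ‖x‖ ≤ 1 →
      Tendsto (fun n => Finsupp.linearCombination 𝕜 g (u n) x) atTop (𝓝 0) := by
    intro x hx
    rw [NormedAddGroup.tendsto_nhds_zero]
    intro ε hε
    exact (hu.eventually_norm_le hg (t := ε / 2) (by rw [h0]; positivity) hx).mono
      fun n hn => hn.trans_lt (by linarith)
  have hlim : ∀ x : X, Tendsto (fun n => Finsupp.linearCombination 𝕜 g (u n) x) atTop (𝓝 0) := by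
    intro x
    have hr : (0 : ℝ) < ‖x‖ + 1 := by positivity
    have hr' : ((‖x‖ + 1 : ℝ) : 𝕜) ≠ 0 := by exact_mod_cast hr.ne'
    have h1 := (hball (((‖x‖ + 1 : ℝ) : 𝕜)⁻¹ • x) (by
      rw [norm_smul, norm_inv, RCLike.norm_ofReal, abs_of_pos hr, inv_mul_le_iff₀ hr]
      linarith)).const_mul ((‖x‖ + 1 : ℝ) : 𝕜)
    rw [mul_zero] at h1
    refine h1.congr fun n => ?_
    rw [map_smul, smul_eq_mul, mul_inv_cancel_left₀ hr']
  refine .of_surjective _ (toCZero_surjective _ 1 hC hlim hc fun a N => ?_)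
  -- Disjoint supports make the `ℓ₁` norm of this combination equal to `∑ ‖a n‖`, so the blocks
  -- inherit the constant `c`.
  have h1 := hl (∑ n ∈ Finset.range N, a n • u n)
  rw [l1Norm_sum, map_sum] at h1
  · simpa [l1Norm_smul, hu.norm_eq] using h1
  · intro m _ n _ hmn
    exact (hu.disjoint hmn).mono Finsupp.support_smul Finsupp.support_smul

end Blocks

/-! ### Realising all sign patterns. -/

section Tree

variable {𝕜 : Type*} [RCLike 𝕜]

theorem IsBlockSeq.average {w : ℕ → ℕ →₀ 𝕜} (hw : IsBlockSeq w) {ι : Type*} [Fintype ι]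
    [Nonempty ι] {m : ι → ℕ → ℕ} (hm : Function.Injective fun q : ι × ℕ => m q.1 q.2) {s : ι → 𝕜}
    (hs : ∀ i, ‖s i‖ = 1) :
    IsBlockSeq fun n => ∑ i, ((Fintype.card ι : 𝕜)⁻¹ * s i) • w (m i n) := by
  classical
  have hd : ∀ i n j k, (i, n) ≠ (j, k) → Disjoint (((Fintype.card ι : 𝕜)⁻¹ * s i) • w (m i n)).support
      (((Fintype.card ι : 𝕜)⁻¹ * s j) • w (m j k)).support := fun i n j k h =>
    (hw.disjoint fun h' => h (hm h')).mono Finsupp.support_smul Finsupp.support_smul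
  refine ⟨fun n => ?_, fun a b hab => ?_⟩
  · rw [l1Norm_sum _ _ fun i _ j _ hij => hd i n j n (by simpa using hij)]
    simp [l1Norm_smul, hw.norm_eq, hs]
  · refine Disjoint.mono Finsupp.support_finsetSum Finsupp.support_finsetSum ?_
    rw [Finset.disjoint_biUnion_left]
    intro i _
    rw [Finset.disjoint_biUnion_right]
    intro j _
    exact hd i a j b (by simp [hab])

theorem refines_average (w : ℕ → ℕ →₀ 𝕜) {ι : Type*} [Fintype ι]
    [Nonempty ι] {m : ι → ℕ → ℕ} (hm : ∀ i, Tendsto (m i) atTop atTop) {s : ι → 𝕜}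
    (hs : ∀ i, ‖s i‖ = 1) :
    Refines (fun n => ∑ i, ((Fintype.card ι : 𝕜)⁻¹ * s i) • w (m i n)) w := by
  intro k
  filter_upwards [eventually_all.2 fun i => (hm i).eventually_ge_atTop k] with n hn p t hp
  calc p (∑ i, ((Fintype.card ι : 𝕜)⁻¹ * s i) • w (m i n))
      ≤ ∑ i, p (((Fintype.card ι : 𝕜)⁻¹ * s i) • w (m i n)) :=
        Finset.le_sum_of_subadditive p (map_zero p).le (map_add_le_add p) _ _
    _ ≤ ∑ _i : ι, (Fintype.card ι : ℝ)⁻¹ * t := by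
        refine Finset.sum_le_sum fun i _ => ?_
        rw [map_smul_eq_mul, norm_mul, hs, mul_one, norm_inv, RCLike.norm_natCast]
        gcongr
        exact hp _ (hn i)
    _ = t := by simp

theorem RCLike.sq_norm_sub_ofReal (y : 𝕜) (δ : ℝ) :
    ‖y - (δ : 𝕜)‖ ^ 2 = ‖y‖ ^ 2 - 2 * δ * RCLike.re y + δ ^ 2 := by
  rw [RCLike.norm_sq_eq_def, RCLike.norm_sq_eq_def]
  simp
  ring

/-- If all `y i` have norm at most `δ + η` and their average has real part at least `δ - 2 * η`,
then all of them are close to `δ`. -/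
theorem norm_sub_le_of_le_re_sum {ι : Type*} [Fintype ι] {y : ι → 𝕜} {δ η κ : ℝ}
    (hδ0 : 0 ≤ δ) (hδ : δ ≤ 1) (hη : 0 ≤ η) (hη1 : η ≤ 1) (hκ : 0 ≤ κ)
    (hηκ : 9 * Fintype.card ι * η ≤ κ ^ 2) (hy : ∀ i, ‖y i‖ ≤ δ + η)
    (hs : Fintype.card ι * (δ - 2 * η) ≤ ∑ i, RCLike.re (y i)) (i : ι) : ‖y i - (δ : 𝕜)‖ ≤ κ := by
  classical
  have h1 : ∑ j ∈ Finset.univ.erase i, RCLike.re (y j) ≤ ∑ j ∈ Finset.univ.erase i, (δ + η) :=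
    Finset.sum_le_sum fun j _ => (RCLike.re_le_norm _).trans (hy j)
  have h2 := Finset.add_sum_erase Finset.univ (fun j => RCLike.re (y j)) (Finset.mem_univ i)
  have hK : 1 ≤ Fintype.card ι := Fintype.card_pos_iff.2 ⟨i⟩
  have hK' : (1 : ℝ) ≤ Fintype.card ι := by exact_mod_cast hK
  rw [Finset.sum_const, Finset.card_erase_of_mem (Finset.mem_univ i), Finset.card_univ,
    nsmul_eq_mul, Nat.cast_sub hK, Nat.cast_one] at h1
  set K : ℝ := (Fintype.card ι : ℝ)
  -- Subtracting the other `K - 1` terms, each at most `δ + η`, from the lower bound on the sum. The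
  -- squared distance to `δ` is then at most `2 * δ * η + η ^ 2 + 6 * K * δ * η`, hence at most `9 *
  -- K * η`.
  have hre : δ - 3 * K * η ≤ RCLike.re (y i) := by nlinarith
  refine abs_le_of_sq_le_sq' ?_ hκ |>.2
  rw [RCLike.sq_norm_sub_ofReal]
  have h3 : ‖y i‖ ^ 2 ≤ (δ + η) ^ 2 := by
    gcongr
    exact hy i
  have h4 : δ * (δ - 3 * K * η) ≤ δ * RCLike.re (y i) := by gcongr
  have h5 : η * η ≤ η := mul_le_of_le_one_left hη hη1
  have h6 : δ * η ≤ η := mul_le_of_le_one_left hη hδ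
  have h7 : δ * η * K ≤ η * K := by gcongr
  have h8 : η ≤ η * K := le_mul_of_one_le_right hη hK'
  nlinarith

variable {X : Type*} [NormedAddCommGroup X] [NormedSpace 𝕜 X] {g : ℕ → StrongDual 𝕜 X}

/-- For a stable block sequence of functionals, finitely many subsequences can simultaneously be
made to take prescribed values of extremal modulus. -/
theorem IsBlockSeq.exists_frequently_prescribed (hg : ∀ n, ‖g n‖ ≤ 1) {w : ℕ → ℕ →₀ 𝕜}
    (hw : IsBlockSeq w)
    (hst : ∀ v, IsBlockSeq v → Refines v w → tailSize g v = tailSize g w)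
    (hpos : 0 < tailSize g w) {ι : Type*} [Fintype ι] [Nonempty ι] {m : ι → ℕ → ℕ}
    (hm : Function.Injective fun q : ι × ℕ => m q.1 q.2) {s : ι → 𝕜} (hs : ∀ i, ‖s i‖ = 1)
    {κ : ℝ} (hκ : 0 < κ) :
    ∃ x : X, ‖x‖ ≤ 1 ∧ ∃ᶠ n in atTop, ∀ i,
      ‖Finsupp.linearCombination 𝕜 g (w (m i n)) x - s i * (tailSize g w : 𝕜)‖ ≤ κ := by
  set δ := tailSize g w with hδ
  have hδ1 : δ ≤ 1 := csInf_le (bddBelow_tailBounds w) (hw.one_mem_tailBounds hg)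
  have hmi : ∀ i, Tendsto (m i) atTop atTop := fun i => by
    refine Function.Injective.nat_tendsto_atTop fun a b hab => ?_
    simpa using hm (a₁ := (i, a)) (a₂ := (i, b)) hab
  have hs' : ∀ i, ‖(s i)⁻¹‖ = 1 := fun i => by rw [norm_inv, hs, inv_one]
  -- The inverse signs align the desired values `s i * δ`, so a nearly extremal value of the average
  -- forces every term to be near its target.
  set v : ℕ → ℕ →₀ 𝕜 := fun n => ∑ i, ((Fintype.card ι : 𝕜)⁻¹ * (s i)⁻¹) • w (m i n) with hv
  have hvb : IsBlockSeq v := hw.average hm hs'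
  have hvδ : tailSize g v = δ := hst v hvb (refines_average w hmi hs')
  have hK : (1 : ℝ) ≤ Fintype.card ι := by exact_mod_cast Nat.one_le_iff_ne_zero.2 Fintype.card_ne_zero
  set η : ℝ := min (min δ 1) (κ ^ 2 / (9 * Fintype.card ι)) with hη
  have hη0 : 0 < η := by positivity
  have hηδ : η ≤ δ := (min_le_left _ _).trans (min_le_left _ _)
  have hη1 : η ≤ 1 := (min_le_left _ _).trans (min_le_right _ _)
  have hηκ : 9 * Fintype.card ι * η ≤ κ ^ 2 := by
    have : η ≤ κ ^ 2 / (9 * Fintype.card ι) := min_le_right _ _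
    rwa [le_div_iff₀ (by positivity), mul_comm] at this
  obtain ⟨x₀, hx₀, hfreq⟩ := exists_frequently_lt_norm (g := g) (u := v) (t := δ - η)
    (by linarith) (by rw [hvδ]; linarith)
  -- The large values of the average may have varying phases. A cluster point `z` along these
  -- indices fixes one phase, and `θ` rotates it away; `‖z‖ ≥ δ - η` and closeness `η` to `z`
  -- account for the loss `2 * η`.
  let l : Filter ℕ := atTop ⊓ 𝓟 {n | δ - η < ‖Finsupp.linearCombination 𝕜 g (v n) x₀‖}
  have hl : l.NeBot := frequently_mem_iff_neBot.1 hfreq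
  have hmem : ∀ᶠ n in l, Finsupp.linearCombination 𝕜 g (v n) x₀ ∈
      Metric.closedBall (0 : 𝕜) 1 ∩ {z | δ - η ≤ ‖z‖} := by
    have h1 : ∀ᶠ n in l, n ∈ {n | δ - η < ‖Finsupp.linearCombination 𝕜 g (v n) x₀‖} :=
      mem_inf_of_right (mem_principal_self _)
    filter_upwards [h1] with n hn
    refine ⟨?_, le_of_lt hn⟩
    rw [mem_closedBall_zero_iff]
    have h2 := norm_linearCombination_le g hg (v n)
    rw [hvb.norm_eq] at h2
    exact (ContinuousLinearMap.le_of_opNorm_le_of_le _ h2 hx₀).trans (by norm_num)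
  obtain ⟨z, ⟨-, hz⟩, hzc⟩ := ((isCompact_closedBall (0 : 𝕜) 1).inter_right
    (isClosed_le continuous_const continuous_norm)).exists_mapClusterPt
      (f := l) (u := fun n => Finsupp.linearCombination 𝕜 g (v n) x₀)
    (le_principal_iff.2 (mem_map.2 hmem))
  obtain ⟨θ, hθ, hθz⟩ := RCLike.exists_norm_one_mul_eq_norm z
  have hx : ‖θ • x₀‖ ≤ 1 := by rwa [norm_smul, hθ, one_mul]
  refine ⟨θ • x₀, hx, ?_⟩
  have hf1 : ∃ᶠ n in atTop, Finsupp.linearCombination 𝕜 g (v n) x₀ ∈ Metric.ball z η :=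
    (hzc.frequently (Metric.ball_mem_nhds z hη0)).filter_mono inf_le_left
  have hf2 : ∀ᶠ n in atTop, ∀ i, ‖Finsupp.linearCombination 𝕜 g (w (m i n)) (θ • x₀)‖ ≤ δ + η :=
    eventually_all.2 fun i => (hmi i).eventually
      (hw.eventually_norm_le hg (t := δ + η) (by linarith) hx)
  refine (hf1.and_eventually hf2).mono fun n ⟨hn1, hn2⟩ i => ?_
  have hs0 : ∀ i, s i ≠ 0 := fun i => norm_ne_zero_iff.1 (by rw [hs]; exact one_ne_zero)
  let y : ι → 𝕜 := fun i => (s i)⁻¹ * Finsupp.linearCombination 𝕜 g (w (m i n)) (θ • x₀)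
  have hy : ∀ i, ‖y i‖ ≤ δ + η := fun i => by
    rw [norm_mul, hs', one_mul]
    exact hn2 i
  have hsum : ∑ i, y i = Fintype.card ι * (θ * Finsupp.linearCombination 𝕜 g (v n) x₀) := by
    have hK0 : (Fintype.card ι : 𝕜) ≠ 0 := by exact_mod_cast Fintype.card_ne_zero
    simp only [hv, y, map_sum, map_smul, sum_apply, smul_apply, smul_eq_mul, Finset.mul_sum]
    refine Finset.sum_congr rfl fun i _ => ?_
    field_simp
  have hre : Fintype.card ι * (δ - 2 * η) ≤ ∑ i, RCLike.re (y i) := by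
    rw [← map_sum, hsum, ← RCLike.ofReal_natCast (K := 𝕜), RCLike.re_ofReal_mul]
    gcongr
    have h1 : θ * Finsupp.linearCombination 𝕜 g (v n) x₀ =
        (‖z‖ : 𝕜) + θ * (Finsupp.linearCombination 𝕜 g (v n) x₀ - z) := by
      rw [← hθz]; ring
    have h2 : ‖θ * (Finsupp.linearCombination 𝕜 g (v n) x₀ - z)‖ < η := by
      rw [norm_mul, hθ, one_mul, ← dist_eq_norm]
      exact hn1
    have h3 := (abs_le.1 (RCLike.abs_re_le_norm
      (θ * (Finsupp.linearCombination 𝕜 g (v n) x₀ - z)))).1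
    rw [h1, map_add, RCLike.ofReal_re]
    have hz' : δ - η ≤ ‖z‖ := hz
    linarith
  have hfin := norm_sub_le_of_le_re_sum hpos.le hδ1 hη0.le hη1 hκ.le hηκ hy hre i
  have : Finsupp.linearCombination 𝕜 g (w (m i n)) (θ • x₀) - s i * (δ : 𝕜) =
      s i * (y i - (δ : 𝕜)) := by
    simp only [y, mul_sub, mul_inv_cancel_left₀ (hs0 i)]
  rwa [this, norm_mul, hs, one_mul]

/-- The scalar `1` or `-1`. -/
def boolSign (𝕜 : Type*) [RCLike 𝕜] (b : Bool) : 𝕜 := if b then 1 else -1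

theorem norm_boolSign (b : Bool) : ‖boolSign 𝕜 b‖ = 1 := by
  cases b <;> simp [boolSign]

/-- All sign patterns on `x 0, …, x (N - 1)` are attained, up to `κ`, by infinitely many of the
functionals `G n`. -/
def AttainsSigns (G : ℕ → StrongDual 𝕜 X) (δ κ : ℝ) (N : ℕ) (x : ℕ → X) : Prop :=
  (∀ k, ‖x k‖ ≤ 1) ∧
    ∀ σ : ℕ → Bool, {n | ∀ k < N, ‖G n (x k) - boolSign 𝕜 (σ k) * (δ : 𝕜)‖ ≤ κ}.Infinite

theorem boolSign_eq_of_norm_sub_le {z : 𝕜} {δ κ : ℝ} (hκδ : κ < δ) {b c : Bool}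
    (hb : ‖z - boolSign 𝕜 b * (δ : 𝕜)‖ ≤ κ) (hc : ‖z - boolSign 𝕜 c * (δ : 𝕜)‖ ≤ κ) : b = c := by
  by_contra hne
  have h1 : ‖boolSign 𝕜 b * (δ : 𝕜) - boolSign 𝕜 c * (δ : 𝕜)‖ ≤ κ + κ := by
    rw [← sub_sub_sub_cancel_left _ _ z]
    exact (norm_sub_le _ _).trans (add_le_add hc hb)
  have h2 : ‖boolSign 𝕜 b - boolSign 𝕜 c‖ = 2 := by
    cases b <;> cases c <;> simp_all [boolSign] <;> norm_num
  rw [← sub_mul, norm_mul, h2, RCLike.norm_ofReal] at h1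
  linarith [le_abs_self δ]

/-- Each of the `2 ^ N` old patterns is attained on an infinite index set, and these sets are
disjoint because `κ < δ`. Splitting each set in two and prescribing opposite signs on the halves
yields the new vector. -/
theorem IsBlockSeq.attainsSigns_succ (hg : ∀ n, ‖g n‖ ≤ 1) {w : ℕ → ℕ →₀ 𝕜}
    (hw : IsBlockSeq w)
    (hst : ∀ v, IsBlockSeq v → Refines v w → tailSize g v = tailSize g w)
    (hpos : 0 < tailSize g w) {κ : ℝ} (hκ : 0 < κ) (hκδ : κ < tailSize g w) {N : ℕ} {x : ℕ → X}
    (hx : AttainsSigns (fun n => Finsupp.linearCombination 𝕜 g (w n)) (tailSize g w) κ N x) :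
    ∃ y, AttainsSigns (fun n => Finsupp.linearCombination 𝕜 g (w n)) (tailSize g w) κ (N + 1)
      (Function.update x N y) := by
  set G := fun n => Finsupp.linearCombination 𝕜 g (w n)
  set δ := tailSize g w
  let ext : (Fin N → Bool) → ℕ → Bool := fun s k => if h : k < N then s ⟨k, h⟩ else false
  let M : (Fin N → Bool) → Set ℕ := fun s =>
    {n | ∀ k < N, ‖G n (x k) - boolSign 𝕜 (ext s k) * (δ : 𝕜)‖ ≤ κ}
  have hM : ∀ s, (M s).Infinite := fun s => hx.2 (ext s)
  -- Even and odd positions in the enumeration of `M i.1` carry the two values of the new sign.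
  let m : (Fin N → Bool) × Bool → ℕ → ℕ := fun i n => Nat.nth (· ∈ M i.1) (2 * n + i.2.toNat)
  have hmM : ∀ i n, m i n ∈ M i.1 := fun i n => Nat.nth_mem_of_infinite (hM i.1) _
  have hm : Function.Injective fun q : ((Fin N → Bool) × Bool) × ℕ => m q.1 q.2 := by
    rintro ⟨⟨s, b⟩, n⟩ ⟨⟨s', b'⟩, n'⟩ h
    have h' : m (s, b) n = m (s', b') n' := h
    obtain rfl : s = s' := by
      funext k
      have e1 := hmM (s, b) n k k.2
      have e2 := hmM (s', b') n' k k.2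
      rw [← h'] at e2
      simpa [ext] using boolSign_eq_of_norm_sub_le hκδ e1 e2
    have h2 := (Nat.nth_strictMono (hM s)).injective h'
    cases b <;> cases b' <;> simp at h2 ⊢ <;> lia
  obtain ⟨y, hy, hfreq⟩ := hw.exists_frequently_prescribed hg hst hpos hm
    (s := fun i => boolSign 𝕜 i.2) (fun i => norm_boolSign _) hκ
  refine ⟨y, fun k => ?_, fun σ => ?_⟩
  · rcases eq_or_ne k N with rfl | hk
    · simpa using hy
    · simpa [hk] using hx.1 k
  · let i : (Fin N → Bool) × Bool := (fun k => σ k, σ N)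
    have hinj : Function.Injective (m i) := fun a b hab => by
      simpa using hm (a₁ := (i, a)) (a₂ := (i, b)) hab
    refine ((Nat.frequently_atTop_iff_infinite.1 hfreq).image hinj.injOn).mono ?_
    rintro _ ⟨n, hn, rfl⟩ k hk
    rcases (Nat.lt_succ_iff.1 hk).eq_or_lt with rfl | hk'
    · rw [Function.update_self]
      exact hn i
    · rw [Function.update_of_ne hk'.ne]
      simpa [i, ext, hk'] using hmM i n k hk'

theorem IsBlockSeq.exists_attainsSigns (hg : ∀ n, ‖g n‖ ≤ 1) {w : ℕ → ℕ →₀ 𝕜}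
    (hw : IsBlockSeq w)
    (hst : ∀ v, IsBlockSeq v → Refines v w → tailSize g v = tailSize g w)
    (hpos : 0 < tailSize g w) {κ : ℝ} (hκ : 0 < κ) (hκδ : κ < tailSize g w) :
    ∃ x : ℕ → X, ∀ N,
      AttainsSigns (fun n => Finsupp.linearCombination 𝕜 g (w n)) (tailSize g w) κ N x := by
  set G := fun n => Finsupp.linearCombination 𝕜 g (w n)
  set δ := tailSize g w
  choose nxt hnxt using fun N (x : {x : ℕ → X // AttainsSigns G δ κ N x}) =>
    hw.attainsSigns_succ hg hst hpos hκ hκδ x.2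
  let F : (N : ℕ) → {x : ℕ → X // AttainsSigns G δ κ N x} := fun N =>
    Nat.rec ⟨0, by simp [AttainsSigns, Set.infinite_univ]⟩
      (fun N x => ⟨Function.update x.1 N (nxt N x), hnxt N x⟩) N
  have hF : ∀ N, (F (N + 1)).1 = Function.update (F N).1 N (nxt N (F N)) := fun N => rfl
  have hFk : ∀ k N, k < N → (F N).1 k = (F (k + 1)).1 k := by
    intro k N hk
    induction N, hk using Nat.le_induction with
    | base => rfl
    | succ N hN ih => rw [hF N, Function.update_of_ne (by lia), ih]
  -- Stage `N` changes only coordinate `N`, so coordinate `k` is final from stage `k + 1` on.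
  refine ⟨fun k => (F (k + 1)).1 k, fun N => ⟨fun k => (F (k + 1)).2.1 k, fun σ => ?_⟩⟩
  refine ((F N).2.2 σ).mono fun n hn k hk => ?_
  change ‖G n ((F (k + 1)).1 k) - _‖ ≤ κ
  rw [← hFk k N hk]
  exact hn k hk

/-- Bounded sequences of functionals converge weak* along ultrafilters. -/
theorem exists_weakStar_ultralimit (U : Ultrafilter ℕ) {u : ℕ → StrongDual 𝕜 X} {r : ℝ}
    (hu : ∀ n, ‖u n‖ ≤ r) :
    ∃ γ : StrongDual 𝕜 X, ‖γ‖ ≤ r ∧ ∀ x, Tendsto (fun n => u n x) U (𝓝 (γ x)) := by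
  have hK := WeakDual.isCompact_closedBall (0 : StrongDual 𝕜 X) r
  obtain ⟨γ, hγ, hlim⟩ := hK.ultrafilter_le_nhds (U.map fun n => StrongDual.toWeakDual (u n)) <| by
    rw [le_principal_iff]
    refine Ultrafilter.mem_map.2 (univ_mem' fun n => ?_)
    simpa using hu n
  refine ⟨WeakDual.toStrongDual γ, by simpa using hγ, fun x => ?_⟩
  exact ((WeakDual.eval_continuous x).tendsto γ).comp hlim

/-- The unit ball of the dual attains all infinite sign patterns on `x`, up to `κ`. -/
theorem exists_dual_signs {G : ℕ → StrongDual 𝕜 X} (hG : ∀ n, ‖G n‖ ≤ 1) {δ κ : ℝ} {x : ℕ → X}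
    (h : ∀ N, AttainsSigns G δ κ N x) (σ : ℕ → Bool) :
    ∃ γ : StrongDual 𝕜 X, ‖γ‖ ≤ 1 ∧ ∀ k, ‖γ (x k) - boolSign 𝕜 (σ k) * (δ : 𝕜)‖ ≤ κ := by
  choose n hn using fun N => ((h N).2 σ).nonempty
  obtain ⟨γ, hγ, hlim⟩ := exists_weakStar_ultralimit (hyperfilter ℕ) (u := fun N => G (n N))
    fun N => hG _
  refine ⟨γ, hγ, fun k => ?_⟩
  have hU : ((hyperfilter ℕ : Ultrafilter ℕ) : Filter ℕ) ≤ atTop := Nat.hyperfilter_le_atTop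
  refine le_of_tendsto ((hlim (x k)).sub_const _).norm ?_
  exact ((eventually_gt_atTop k).filter_mono hU).mono fun N hN => hn N k hN

end Tree

/-! ### Rademacher sums, Khintchine and Bessel inequalities. -/

section Rademacher

variable {𝕜 : Type*} [RCLike 𝕜]

/-- The sum of the `a k`, `k < n`, with the signs `1` on `A` and `-1` off `A`. -/
def radSum (a : ℕ → 𝕜) (n : ℕ) (A : Finset ℕ) : 𝕜 :=
  ∑ k ∈ Finset.range n, boolSign 𝕜 (decide (k ∈ A)) * a k

theorem sum_powerset_range_succ {M : Type*} [AddCommMonoid M] (N : ℕ) (h : Finset ℕ → M) :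
    ∑ A ∈ (Finset.range (N + 1)).powerset, h A =
      ∑ A ∈ (Finset.range N).powerset, (h A + h (insert N A)) := by
  rw [Finset.range_add_one, Finset.sum_powerset_insert Finset.notMem_range_self,
    Finset.sum_add_distrib]

theorem radSum_succ (a : ℕ → 𝕜) {N : ℕ} {A : Finset ℕ} (hA : A ∈ (Finset.range N).powerset) :
    radSum a (N + 1) A = radSum a N A - a N := by
  have : N ∉ A := fun h => by simpa using Finset.mem_powerset.1 hA h
  simp [radSum, Finset.sum_range_succ, this, boolSign, sub_eq_add_neg]

theorem radSum_succ_insert (a : ℕ → 𝕜) (N : ℕ) (A : Finset ℕ) :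
    radSum a (N + 1) (insert N A) = radSum a N A + a N := by
  have : radSum a N (insert N A) = radSum a N A := by
    refine Finset.sum_congr rfl fun k hk => ?_
    have : k ≠ N := (Finset.mem_range.1 hk).ne
    simp [this]
  rw [← this]
  simp [radSum, Finset.sum_range_succ, boolSign]

theorem radSum_of_le (a : ℕ → 𝕜) {n N : ℕ} (h : n ≤ N) (A : Finset ℕ) :
    radSum (fun k => if k < n then a k else 0) N A = radSum a n A := by
  have h1 : ∀ k ∈ Finset.range N, k ∉ Finset.range n →
      boolSign 𝕜 (decide (k ∈ A)) * (if k < n then a k else 0) = 0 := fun k _ hk => by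
    simp [Finset.mem_range.not.1 hk]
  rw [radSum, ← Finset.sum_subset (Finset.range_mono h) h1]
  refine Finset.sum_congr rfl fun k hk => ?_
  rw [if_pos (Finset.mem_range.1 hk)]

theorem sum_sq_of_le (a : ℕ → 𝕜) {n N : ℕ} (h : n ≤ N) :
    ∑ k ∈ Finset.range N, ‖(if k < n then a k else 0)‖ ^ 2 = ∑ k ∈ Finset.range n, ‖a k‖ ^ 2 := by
  rw [← Finset.sum_subset (Finset.range_mono h) fun k _ hk => by
    simp [Finset.mem_range.not.1 hk]]
  refine Finset.sum_congr rfl fun k hk => ?_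
  rw [if_pos (Finset.mem_range.1 hk)]

theorem sum_norm_radSum_sq_self (a : ℕ → 𝕜) (N : ℕ) :
    ∑ A ∈ (Finset.range N).powerset, ‖radSum a N A‖ ^ 2 =
      2 ^ N * ∑ k ∈ Finset.range N, ‖a k‖ ^ 2 := by
  induction N with
  | zero => simp [radSum]
  | succ N ih =>
    rw [sum_powerset_range_succ]
    have : ∀ A ∈ (Finset.range N).powerset, ‖radSum a (N + 1) A‖ ^ 2 +
        ‖radSum a (N + 1) (insert N A)‖ ^ 2 = 2 * ‖radSum a N A‖ ^ 2 + 2 * ‖a N‖ ^ 2 := by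
      intro A hA
      rw [radSum_succ a hA, radSum_succ_insert]
      have := parallelogram_law_with_norm 𝕜 (radSum a N A) (a N)
      linarith
    rw [Finset.sum_congr rfl this, Finset.sum_add_distrib, ← Finset.mul_sum, ih,
      Finset.sum_const, Finset.card_powerset, Finset.card_range, Finset.sum_range_succ,
      nsmul_eq_mul]
    push_cast
    ring

/-- Induction through `(s - a) ^ 4 + (s + a) ^ 4 = 2 * s ^ 4 + 12 * a ^ 2 * s ^ 2 + 2 * a ^ 4`; the
middle term averages to the second moment, which is known exactly. -/
theorem sum_radSum_pow_four_self (a : ℕ → ℝ) (N : ℕ) :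
    ∑ A ∈ (Finset.range N).powerset, radSum a N A ^ 4 ≤
      3 * 2 ^ N * (∑ k ∈ Finset.range N, ‖a k‖ ^ 2) ^ 2 := by
  induction N with
  | zero => simp [radSum]
  | succ N ih =>
    rw [sum_powerset_range_succ]
    have : ∀ A ∈ (Finset.range N).powerset, radSum a (N + 1) A ^ 4 +
        radSum a (N + 1) (insert N A) ^ 4 =
          2 * radSum a N A ^ 4 + 12 * a N ^ 2 * ‖radSum a N A‖ ^ 2 + 2 * a N ^ 4 := by
      intro A hA
      rw [radSum_succ a hA, radSum_succ_insert, Real.norm_eq_abs, sq_abs]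
      ring
    rw [Finset.sum_congr rfl this, Finset.sum_add_distrib, Finset.sum_add_distrib,
      ← Finset.mul_sum, ← Finset.mul_sum, sum_norm_radSum_sq_self, Finset.sum_const,
      Finset.card_powerset, Finset.card_range, Finset.sum_range_succ, nsmul_eq_mul,
      Real.norm_eq_abs (a N), sq_abs]
    push_cast
    have h2 : (0 : ℝ) ≤ 2 ^ N * a N ^ 4 := by positivity
    linear_combination 2 * ih + 4 * h2

theorem sum_norm_radSum_sq (a : ℕ → 𝕜) {n N : ℕ} (h : n ≤ N) :
    ∑ A ∈ (Finset.range N).powerset, ‖radSum a n A‖ ^ 2 =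
      2 ^ N * ∑ k ∈ Finset.range n, ‖a k‖ ^ 2 := by
  have := sum_norm_radSum_sq_self (fun k => if k < n then a k else 0) N
  simpa only [radSum_of_le a h, sum_sq_of_le a h] using this

theorem sum_radSum_pow_four_le (a : ℕ → ℝ) {n N : ℕ} (h : n ≤ N) :
    ∑ A ∈ (Finset.range N).powerset, radSum a n A ^ 4 ≤
      3 * 2 ^ N * (∑ k ∈ Finset.range n, ‖a k‖ ^ 2) ^ 2 := by
  have := sum_radSum_pow_four_self (fun k => if k < n then a k else 0) N
  simpa only [radSum_of_le a h, sum_sq_of_le a h] using this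

theorem sum_norm_radSum_le (a : ℕ → 𝕜) {n N : ℕ} (h : n ≤ N) :
    ∑ A ∈ (Finset.range N).powerset, ‖radSum a n A‖ ≤
      2 ^ N * √(∑ k ∈ Finset.range n, ‖a k‖ ^ 2) := by
  have h1 := sq_sum_le_card_mul_sum_sq (s := (Finset.range N).powerset)
    (f := fun A => ‖radSum a n A‖)
  rw [sum_norm_radSum_sq a h, Finset.card_powerset, Finset.card_range] at h1
  push_cast at h1
  refine abs_le_of_sq_le_sq' ?_ (by positivity) |>.2
  rw [mul_pow, Real.sq_sqrt (Finset.sum_nonneg fun _ _ => by positivity)]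
  linarith

/-- The lower Khintchine inequality in `L₁`. -/
theorem le_sum_abs_radSum (a : ℕ → ℝ) {n N : ℕ} (h : n ≤ N) :
    2 ^ N * (5 / 9 * √(∑ k ∈ Finset.range n, ‖a k‖ ^ 2)) ≤
      ∑ A ∈ (Finset.range N).powerset, |radSum a n A| := by
  set Q := ∑ k ∈ Finset.range n, ‖a k‖ ^ 2 with hQ
  have hQ0 : 0 ≤ Q := Finset.sum_nonneg fun _ _ => by positivity
  set l := √Q with hl
  have hlQ : l ^ 2 = Q := Real.sq_sqrt hQ0
  rcases (Real.sqrt_nonneg Q).eq_or_lt with h0 | h0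
  · rw [hl, ← h0]
    simpa using Finset.sum_nonneg fun A _ => abs_nonneg (radSum a n A)
  rw [← hl] at h0
  -- With `u = |s| / l` this is `u - u ^ 2 + 4 / 27 * u ^ 4 = u * (1 - 2 * u / 3) ^ 2 * (1 + u / 3)
  -- ≥ 0`. Averaging, the second and fourth moments give `l - 4 / 9 * l`.
  have hpt : ∀ s : ℝ, l⁻¹ * ‖s‖ ^ 2 - 4 / 27 * l⁻¹ ^ 3 * s ^ 4 ≤ |s| := by
    intro s
    have hs4 : s ^ 4 = |s| ^ 4 := by
      rw [show (4 : ℕ) = 2 * 2 from rfl, pow_mul, pow_mul, sq_abs]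
    obtain ⟨u, hu⟩ : ∃ u, u = l⁻¹ * |s| := ⟨_, rfl⟩
    have hu0 : 0 ≤ u := by rw [hu]; positivity
    have hs : |s| = l * u := by rw [hu, mul_inv_cancel_left₀ h0.ne']
    have h1 : 0 ≤ l * (u * ((1 - 2 * u / 3) ^ 2 * (1 + u / 3))) := by positivity
    rw [hs4, Real.norm_eq_abs, hs]
    have h2 : l⁻¹ * (l * u) ^ 2 - 4 / 27 * l⁻¹ ^ 3 * (l * u) ^ 4 =
        l * (u ^ 2 - 4 / 27 * u ^ 4) := by
      field_simp
    rw [h2]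
    linear_combination h1
  refine le_trans ?_ (Finset.sum_le_sum fun A _ => hpt (radSum a n A))
  rw [Finset.sum_sub_distrib, ← Finset.mul_sum, ← Finset.mul_sum, sum_norm_radSum_sq a h, ← hQ]
  have h4 := mul_le_mul_of_nonneg_left (sum_radSum_pow_four_le a h)
    (show (0 : ℝ) ≤ 4 / 27 * l⁻¹ ^ 3 by positivity)
  rw [← hQ] at h4
  have e1 : l⁻¹ * (2 ^ N * Q) = 2 ^ N * l := by
    rw [← hlQ]; field_simp
  have e2 : 4 / 27 * l⁻¹ ^ 3 * (3 * 2 ^ N * Q ^ 2) = 2 ^ N * (4 / 9 * l) := by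
    rw [← hlQ]; field_simp; norm_num
  rw [e2] at h4
  rw [e1]
  linarith

theorem re_mul_radSum (ω : 𝕜) (a : ℕ → 𝕜) (n : ℕ) (A : Finset ℕ) :
    RCLike.re (ω * radSum a n A) = radSum (fun k => RCLike.re (ω * a k)) n A := by
  rw [radSum, radSum, Finset.mul_sum, map_sum]
  refine Finset.sum_congr rfl fun k _ => ?_
  by_cases h : k ∈ A <;> simp [boolSign, h]

variable {X : Type*} [NormedAddCommGroup X] [NormedSpace 𝕜 X]

/-- The Rademacher coefficients, at level `N`, of a family of functionals indexed by signs. -/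
noncomputable def radAvg (γ : Finset ℕ → StrongDual 𝕜 X) (N k : ℕ) : StrongDual 𝕜 X :=
  ((2 : 𝕜) ^ N)⁻¹ • ∑ A ∈ (Finset.range N).powerset, boolSign 𝕜 (decide (k ∈ A)) • γ A

theorem sum_mul_radAvg (γ : Finset ℕ → StrongDual 𝕜 X) (N n : ℕ) (a : ℕ → 𝕜) (x : X) :
    ∑ k ∈ Finset.range n, a k * radAvg γ N k x =
      ((2 : 𝕜) ^ N)⁻¹ * ∑ A ∈ (Finset.range N).powerset, radSum a n A * γ A x := by
  simp only [radAvg, smul_apply, sum_apply, smul_eq_mul, radSum, Finset.mul_sum, Finset.sum_mul]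
  rw [Finset.sum_comm]
  exact Finset.sum_congr rfl fun A _ => Finset.sum_congr rfl fun k _ => by ring

theorem norm_sum_mul_radAvg_le (γ : Finset ℕ → StrongDual 𝕜 X) {n N : ℕ} (h : n ≤ N) (a : ℕ → 𝕜)
    (x : X) {C : ℝ} (hC : ∀ A, ‖γ A x‖ ≤ C) :
    ‖∑ k ∈ Finset.range n, a k * radAvg γ N k x‖ ≤ √(∑ k ∈ Finset.range n, ‖a k‖ ^ 2) * C := by
  have hC0 : 0 ≤ C := (norm_nonneg _).trans (hC ∅)
  rw [sum_mul_radAvg, norm_mul, norm_inv, norm_pow, RCLike.norm_ofNat,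
    inv_mul_le_iff₀ (by positivity), ← mul_assoc]
  refine le_trans ?_ (mul_le_mul_of_nonneg_right (sum_norm_radSum_le a h) hC0)
  rw [Finset.sum_mul]
  refine norm_sum_le_of_le _ fun A _ => ?_
  rw [norm_mul]
  gcongr
  exact hC A

/-- Bessel's inequality for Rademacher coefficients. -/
theorem sum_norm_radAvg_sq_le (γ : Finset ℕ → StrongDual 𝕜 X) {n N : ℕ} (h : n ≤ N)
    (x : X) {C : ℝ} (hC : ∀ A, ‖γ A x‖ ≤ C) :
    ∑ k ∈ Finset.range n, ‖radAvg γ N k x‖ ^ 2 ≤ C ^ 2 := by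
  have hC0 : 0 ≤ C := (norm_nonneg _).trans (hC ∅)
  -- Testing against the conjugates of the coefficients themselves gives `Q ≤ √Q * C`.
  have h1 := norm_sum_mul_radAvg_le γ h (fun k => (starRingEnd 𝕜) (radAvg γ N k x)) x hC
  have h2 : ∑ k ∈ Finset.range n, (starRingEnd 𝕜) (radAvg γ N k x) * radAvg γ N k x =
      ((∑ k ∈ Finset.range n, ‖radAvg γ N k x‖ ^ 2 : ℝ) : 𝕜) := by
    push_cast
    exact Finset.sum_congr rfl fun k _ => RCLike.conj_mul _
  simp only [RCLike.norm_conj] at h1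
  rw [h2, RCLike.norm_ofReal] at h1
  set Q := ∑ k ∈ Finset.range n, ‖radAvg γ N k x‖ ^ 2
  have hQ0 : 0 ≤ Q := Finset.sum_nonneg fun _ _ => by positivity
  have h3 := Real.sq_sqrt hQ0
  rw [abs_of_nonneg hQ0] at h1
  rcases (Real.sqrt_nonneg Q).eq_or_lt with h0 | h0
  · nlinarith [sq_nonneg C]
  · have h4 : √Q ≤ C := by
      refine le_of_mul_le_mul_left ?_ h0
      nlinarith
    rw [← h3]
    gcongr

/-- The signs of `γ A x` match those of `re (ω * radSum a n A)`, so each `A` contributes the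
absolute value times `δ`, up to `κ * ‖radSum a n A‖`. Khintchine bounds the average of the main
terms, Cauchy–Schwarz that of the errors. -/
theorem le_re_mul_sum_mul_radAvg (γ : Finset ℕ → StrongDual 𝕜 X) {n N : ℕ} (h : n ≤ N)
    (a : ℕ → 𝕜) (x : X) {ω : 𝕜} (hω : ‖ω‖ ≤ 1) {δ κ : ℝ} (hδ : 0 ≤ δ)
    (hx : ∀ A, ‖γ A x - boolSign 𝕜 (decide (0 ≤ RCLike.re (ω * radSum a n A))) * (δ : 𝕜)‖ ≤ κ) :
    5 / 9 * δ * √(∑ k ∈ Finset.range n, ‖RCLike.re (ω * a k)‖ ^ 2) -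
      κ * √(∑ k ∈ Finset.range n, ‖a k‖ ^ 2) ≤
        RCLike.re (ω * ∑ k ∈ Finset.range n, a k * radAvg γ N k x) := by
  have hκ : 0 ≤ κ := (norm_nonneg _).trans (hx ∅)
  have hpt : ∀ A, δ * |radSum (fun k => RCLike.re (ω * a k)) n A| - κ * ‖radSum a n A‖ ≤
      RCLike.re (ω * (radSum a n A * γ A x)) := by
    intro A
    have hxA := hx A
    rw [← re_mul_radSum]
    set S := radSum a n A
    set s := boolSign 𝕜 (decide (0 ≤ RCLike.re (ω * S))) with hs
    have h1 : ω * (S * γ A x) = s * (ω * S) * (δ : 𝕜) + ω * S * (γ A x - s * (δ : 𝕜)) := by ring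
    have h2 : RCLike.re (s * (ω * S)) = |RCLike.re (ω * S)| := by
      by_cases h0 : 0 ≤ RCLike.re (ω * S)
      · rw [abs_of_nonneg h0, hs, decide_eq_true h0, boolSign, if_pos rfl, one_mul]
      · rw [abs_of_neg (not_le.1 h0), hs, decide_eq_false h0, boolSign, if_neg (by simp),
          neg_one_mul, map_neg]
    have h3 := (abs_le.1 (RCLike.abs_re_le_norm (ω * S * (γ A x - s * (δ : 𝕜))))).1
    have h4 : ‖ω * S * (γ A x - s * (δ : 𝕜))‖ ≤ κ * ‖S‖ := by
      rw [norm_mul, norm_mul, mul_comm]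
      have := mul_le_of_le_one_left (norm_nonneg S) hω
      gcongr
    rw [h1, map_add, RCLike.re_mul_ofReal, h2]
    linarith
  have hcast : ((2 : 𝕜) ^ N)⁻¹ = (((2 : ℝ) ^ N)⁻¹ : ℝ) := by push_cast; rfl
  rw [sum_mul_radAvg, mul_left_comm, hcast, RCLike.re_ofReal_mul, Finset.mul_sum, map_sum,
    le_inv_mul_iff₀ (by positivity)]
  refine le_trans ?_ (Finset.sum_le_sum fun A _ => hpt A)
  rw [Finset.sum_sub_distrib, ← Finset.mul_sum, ← Finset.mul_sum]
  have k1 := mul_le_mul_of_nonneg_left (le_sum_abs_radSum (fun k => RCLike.re (ω * a k)) h) hδ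
  have k2 := mul_le_mul_of_nonneg_left (sum_norm_radSum_le a h) hκ
  linarith

end Rademacher

/-! ### Quotients isomorphic to `ℓ₂`. -/

section EllTwoQuotients

variable {𝕜 : Type*} [RCLike 𝕜]

instance : TopologicalSpace.SeparableSpace (EllTwo 𝕜) := by
  have hs : TopologicalSpace.IsSeparable (closure
      (Submodule.span 𝕜 (Set.range fun n : ℕ => lp.single (E := fun _ : ℕ => 𝕜) 2 n (1 : 𝕜)) :
        Set (EllTwo 𝕜))) :=
    (TopologicalSpace.IsSeparable.span (R := 𝕜) (Set.countable_range _).isSeparable).closure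
  refine TopologicalSpace.isSeparable_univ_iff.1 (hs.mono fun a _ => ?_)
  refine mem_closure_of_tendsto (lp.hasSum_single (by norm_num) a).tendsto_sum_nat
    (Eventually.of_forall fun N => Submodule.sum_mem _ fun n _ => ?_)
  have : lp.single (E := fun _ : ℕ => 𝕜) 2 n (a n) = a n • lp.single 2 n (1 : 𝕜) := by
    rw [← lp.single_smul, smul_eq_mul, mul_one]
  rw [this]
  exact Submodule.smul_mem _ _ (Submodule.subset_span ⟨n, rfl⟩)

variable {X : Type*} [NormedAddCommGroup X] [NormedSpace 𝕜 X]

theorem sum_sq_le_of_range {a : ℕ → 𝕜} {C : ℝ}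
    (h : ∀ n, ∑ k ∈ Finset.range n, ‖a k‖ ^ 2 ≤ C ^ 2) (s : Finset ℕ) :
    ∑ k ∈ s, ‖a k‖ ^ (2 : ENNReal).toReal ≤ C ^ (2 : ENNReal).toReal := by
  simp only [ENNReal.toReal_ofNat, Real.rpow_ofNat]
  obtain ⟨n, hn⟩ := s.exists_nat_subset_range
  exact (Finset.sum_le_sum_of_subset_of_nonneg hn fun _ _ _ => by positivity).trans (h n)

/-- The operator into `ℓ₂` whose coordinates are functionals satisfying a Bessel inequality. -/
noncomputable def toEllTwo (φ : ℕ → StrongDual 𝕜 X)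
    (h : ∀ x n, ∑ k ∈ Finset.range n, ‖φ k x‖ ^ 2 ≤ ‖x‖ ^ 2) : X →L[𝕜] EllTwo 𝕜 :=
  LinearMap.mkContinuous
    { toFun := fun x => ⟨fun k => φ k x, memℓp_gen' (sum_sq_le_of_range (h x))⟩
      map_add' := fun x y => by ext k; exact map_add (φ k) x y
      map_smul' := fun c x => by ext k; exact map_smul (φ k) c x } 1 fun x => by
    rw [one_mul]
    exact lp.norm_le_of_forall_sum_le (by norm_num) (norm_nonneg x) (sum_sq_le_of_range (h x))

@[simp]
theorem toEllTwo_apply (φ : ℕ → StrongDual 𝕜 X)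
    (h : ∀ x n, ∑ k ∈ Finset.range n, ‖φ k x‖ ^ 2 ≤ ‖x‖ ^ 2) (x : X) (k : ℕ) :
    toEllTwo φ h x k = φ k x := rfl

/-- By Riesz representation the adjoint sends a finitely supported `v` to the combination of the `φ
k` with coefficients conjugate to `v k`; density and continuity extend the lower bound to all
functionals. -/
theorem toEllTwo_surjective [CompleteSpace X] (φ : ℕ → StrongDual 𝕜 X)
    (h : ∀ x n, ∑ k ∈ Finset.range n, ‖φ k x‖ ^ 2 ≤ ‖x‖ ^ 2) {c : ℝ} (hc : 0 < c)
    (hl : ∀ (a : ℕ → 𝕜) (n : ℕ), c * √(∑ k ∈ Finset.range n, ‖a k‖ ^ 2) ≤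
      ‖∑ k ∈ Finset.range n, a k • φ k‖) : Function.Surjective (toEllTwo φ h) := by
  refine ContinuousLinearMap.surjective_of_le_norm_comp _ hc fun ψ => ?_
  set T := toEllTwo φ h
  obtain ⟨v, rfl⟩ := (InnerProductSpace.toDual 𝕜 (EllTwo 𝕜)).surjective ψ
  rw [LinearIsometryEquiv.norm_map]
  have hlim := (lp.hasSum_single (by norm_num) v).tendsto_sum_nat
  have hcont : Continuous fun v : EllTwo 𝕜 =>
      ‖(InnerProductSpace.toDual 𝕜 (EllTwo 𝕜) v).comp T‖ :=
    (((ContinuousLinearMap.compL 𝕜 X (EllTwo 𝕜) 𝕜).flip T).continuous.comp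
      (InnerProductSpace.toDual 𝕜 (EllTwo 𝕜)).continuous).norm
  refine le_of_tendsto_of_tendsto' (hlim.norm.const_mul c) ((hcont.tendsto v).comp hlim)
    fun n => ?_
  have h1 : ‖∑ k ∈ Finset.range n, lp.single 2 k (v k)‖ =
      √(∑ k ∈ Finset.range n, ‖(starRingEnd 𝕜) (v k)‖ ^ 2) := by
    have := lp.norm_sum_single (E := fun _ : ℕ => 𝕜) (p := 2) (by norm_num) (fun k => v k)
      (Finset.range n)
    simp only [ENNReal.toReal_ofNat, Real.rpow_ofNat] at this
    simp only [RCLike.norm_conj]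
    rw [← this, Real.sqrt_sq (norm_nonneg _)]
  have h2 : (InnerProductSpace.toDual 𝕜 (EllTwo 𝕜)
      (∑ k ∈ Finset.range n, lp.single 2 k (v k))).comp T =
        ∑ k ∈ Finset.range n, (starRingEnd 𝕜) (v k) • φ k := by
    ext x
    rw [ContinuousLinearMap.comp_apply, InnerProductSpace.toDual_apply_apply, sum_inner, sum_apply]
    refine Finset.sum_congr rfl fun k _ => ?_
    rw [lp.inner_single_left, smul_apply, smul_eq_mul, toEllTwo_apply, RCLike.inner_apply, mul_comm]
  rw [h1]
  refine (hl _ n).trans ?_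
  rw [Function.comp_apply, h2]

theorem norm_radAvg_le {γ : Finset ℕ → StrongDual 𝕜 X} (hγ : ∀ A, ‖γ A‖ ≤ 1) (N k : ℕ) :
    ‖radAvg γ N k‖ ≤ 1 := by
  rw [radAvg, norm_smul, norm_inv, norm_pow, RCLike.norm_ofNat, inv_mul_le_iff₀ (by positivity)]
  refine (norm_sum_le_of_le (f := fun A => boolSign 𝕜 (decide (k ∈ A)) • γ A)
    (n := fun _ => (1 : ℝ)) _ fun A _ => ?_).trans ?_
  · rw [norm_smul, norm_boolSign, one_mul]
    exact hγ A
  · simp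

theorem sqrt_sum_sq_le_re_im (a : ℕ → 𝕜) (n : ℕ) :
    √(∑ k ∈ Finset.range n, ‖a k‖ ^ 2) ≤
      √(∑ k ∈ Finset.range n, ‖RCLike.re (1 * a k)‖ ^ 2) +
        √(∑ k ∈ Finset.range n, ‖RCLike.re (RCLike.I * a k)‖ ^ 2) := by
  have h : ∑ k ∈ Finset.range n, ‖a k‖ ^ 2 = ∑ k ∈ Finset.range n, ‖RCLike.re (1 * a k)‖ ^ 2 +
      ∑ k ∈ Finset.range n, ‖RCLike.re (RCLike.I * a k)‖ ^ 2 := by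
    rw [← Finset.sum_add_distrib]
    refine Finset.sum_congr rfl fun k _ => ?_
    rw [one_mul, RCLike.I_mul_re, norm_neg, RCLike.norm_sq_eq_def, Real.norm_eq_abs,
      Real.norm_eq_abs, sq_abs, sq_abs, sq, sq]
  rw [h]
  refine Real.sqrt_le_iff.2 ⟨by positivity, ?_⟩
  rw [add_sq, Real.sq_sqrt (Finset.sum_nonneg fun _ _ => by positivity),
    Real.sq_sqrt (Finset.sum_nonneg fun _ _ => by positivity)]
  exact add_le_add_left (le_add_of_nonneg_right (by positivity)) _

/-- If the dual ball attains, up to a small error, all sign patterns on a sequence in the unit ball,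
then `ℓ₂` is a quotient. -/
theorem hasSeparableQuotientIsoTo_ellTwo_of_signs [CompleteSpace X] {δ κ : ℝ} (hδ : 0 < δ)
    (hκ : 16 * κ ≤ δ) {x : ℕ → X} (hx : ∀ k, ‖x k‖ ≤ 1)
    (h : ∀ σ : ℕ → Bool, ∃ γ : StrongDual 𝕜 X, ‖γ‖ ≤ 1 ∧
      ∀ k, ‖γ (x k) - boolSign 𝕜 (σ k) * (δ : 𝕜)‖ ≤ κ) :
    HasSeparableQuotientIsoTo 𝕜 X (EllTwo 𝕜) := by
  -- A pair `(n, S)` encodes an arbitrary sign function of `A ∩ range n`. There are countably many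
  -- pairs, so one sequence of vectors can realise all of them; the value `false` off the range of
  -- `e` plays no role.
  obtain ⟨e, he⟩ := exists_injective_nat (ℕ × Finset (Finset ℕ))
  choose γ hγ hγx using fun A : Finset ℕ =>
    h (Function.extend e (fun j => decide (A ∩ Finset.range j.1 ∈ j.2)) fun _ => false)
  have hγe : ∀ A j, ‖γ A (x (e j)) - boolSign 𝕜 (decide (A ∩ Finset.range j.1 ∈ j.2)) * (δ : 𝕜)‖ ≤
      κ := fun A j => by
    have := hγx A (e j)
    rwa [he.extend_apply] at this
  let U : Ultrafilter ℕ := hyperfilter ℕ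
  have hU : (U : Filter ℕ) ≤ atTop := Nat.hyperfilter_le_atTop
  choose φ hφ hφlim using fun k => exists_weakStar_ultralimit U (u := fun N => radAvg γ N k)
    fun N => norm_radAvg_le hγ N k
  have hbessel : ∀ x n, ∑ k ∈ Finset.range n, ‖φ k x‖ ^ 2 ≤ ‖x‖ ^ 2 := by
    intro x n
    refine le_of_tendsto (tendsto_finsetSum (Finset.range n) fun k _ => (hφlim k x).norm.pow 2) ?_
    filter_upwards [(eventually_ge_atTop n).filter_mono hU] with N hN
    refine sum_norm_radAvg_sq_le γ hN x fun A => ?_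
    exact ((γ A).le_of_opNorm_le (hγ A) x).trans (by rw [one_mul])
  have key : ∀ (ω : 𝕜), ‖ω‖ ≤ 1 → ∀ (a : ℕ → 𝕜) (n : ℕ),
      5 / 9 * δ * √(∑ k ∈ Finset.range n, ‖RCLike.re (ω * a k)‖ ^ 2) -
        κ * √(∑ k ∈ Finset.range n, ‖a k‖ ^ 2) ≤ ‖∑ k ∈ Finset.range n, a k • φ k‖ := by
    intro ω hω a n
    -- This pair selects the vector at which the signs of all `γ A` agree with those of `re (ω *
    -- radSum a n A)`.
    let j : ℕ × Finset (Finset ℕ) :=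
      (n, {A ∈ (Finset.range n).powerset | 0 ≤ RCLike.re (ω * radSum a n A)})
    have hrad : ∀ A, radSum a n (A ∩ Finset.range n) = radSum a n A := fun A =>
      Finset.sum_congr rfl fun k hk => by simp [Finset.mem_range.1 hk]
    have hj : ∀ A, decide (A ∩ Finset.range j.1 ∈ j.2) =
        decide (0 ≤ RCLike.re (ω * radSum a n A)) := fun A => by
      rw [decide_eq_decide, Finset.mem_filter, hrad, Finset.mem_powerset]
      exact and_iff_right Finset.inter_subset_right
    have hlim : Tendsto (fun N => RCLike.re (ω * ∑ k ∈ Finset.range n,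
        a k * radAvg γ N k (x (e j)))) U
        (𝓝 (RCLike.re (ω * ∑ k ∈ Finset.range n, a k * φ k (x (e j))))) :=
      (RCLike.continuous_re.tendsto _).comp <| (tendsto_finsetSum (Finset.range n)
        fun k _ => (hφlim k (x (e j))).const_mul (a k)).const_mul ω
    have h1 : RCLike.re (ω * ∑ k ∈ Finset.range n, a k * φ k (x (e j))) ≤
        ‖∑ k ∈ Finset.range n, a k • φ k‖ := by
      refine (RCLike.re_le_norm _).trans ?_
      rw [norm_mul]
      have h2 := (∑ k ∈ Finset.range n, a k • φ k).le_of_opNorm_le_of_le le_rfl (hx (e j))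
      simp only [sum_apply, smul_apply, smul_eq_mul, mul_one] at h2
      exact (mul_le_of_le_one_left (norm_nonneg _) hω).trans h2
    refine le_trans (ge_of_tendsto hlim ?_) h1
    filter_upwards [(eventually_ge_atTop n).filter_mono hU] with N hN
    refine le_re_mul_sum_mul_radAvg γ hN a _ hω hδ.le fun A => ?_
    have := hγe A j
    rwa [hj] at this
  -- Adding the cases `ω = 1` and `ω = I` gives the constant `(5 / 9 * δ - 2 * κ) / 2`, which
  -- exceeds `δ / 5` because `16 * κ ≤ δ`.
  refine .of_surjective _ (toEllTwo_surjective φ hbessel (c := δ / 5) (by positivity) fun a n => ?_)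
  have k1 := key 1 (by simp) a n
  have k2 := key RCLike.I (by rw [RCLike.norm_I]; split_ifs <;> norm_num) a n
  have k3 := mul_le_mul_of_nonneg_left (sqrt_sum_sq_le_re_im a n) hδ.le
  rw [mul_add] at k3
  have k4 := mul_le_mul_of_nonneg_right hκ (Real.sqrt_nonneg (∑ k ∈ Finset.range n, ‖a k‖ ^ 2))
  have k5 := mul_nonneg hδ.le (Real.sqrt_nonneg (∑ k ∈ Finset.range n, ‖a k‖ ^ 2))
  linarith

end EllTwoQuotients

/-! ### Assembly of the two cases. -/

section Main

variable {𝕜 X : Type*} [RCLike 𝕜] [NormedAddCommGroup X] [NormedSpace 𝕜 X]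

/-- A pointwise convergent sequence in the dual ball converges weak* in the dual ball. -/
theorem exists_tendsto_of_pointwise {u : ℕ → StrongDual 𝕜 X} (hu : ∀ n, ‖u n‖ ≤ 1)
    (h : ∀ x, ∃ z, Tendsto (fun n => u n x) atTop (𝓝 z)) :
    ∃ γ ∈ dualUnitBall 𝕜 X, Tendsto (fun n => StrongDual.toWeakDual (u n)) atTop (𝓝 γ) := by
  obtain ⟨γ, hγ, hlim⟩ := exists_weakStar_ultralimit (hyperfilter ℕ) hu
  have hU : ((hyperfilter ℕ : Ultrafilter ℕ) : Filter ℕ) ≤ atTop := Nat.hyperfilter_le_atTop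
  refine ⟨StrongDual.toWeakDual γ, by simpa [dualUnitBall] using hγ, ?_⟩
  refine tendsto_iff_forall_eval_tendsto_topDualPairing.2 fun x => ?_
  obtain ⟨z, hz⟩ := h x
  have : z = γ x := tendsto_nhds_unique (hz.mono_left hU) (hlim x)
  subst this
  exact hz

/-- If the dual ball is not weak* sequentially compact, the dual contains a bounded sequence with a
lower `ℓ₁` estimate. -/
theorem exists_l1_sequence_of_not_isSeqCompact (h : ¬ IsSeqCompact (dualUnitBall 𝕜 X)) :
    ∃ (g : ℕ → StrongDual 𝕜 X) (c : ℝ), (∀ n, ‖g n‖ ≤ 1) ∧ 0 < c ∧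
      ∀ w : ℕ →₀ 𝕜, c * l1Norm w ≤ ‖Finsupp.linearCombination 𝕜 g w‖ := by
  simp only [IsSeqCompact] at h
  push Not at h
  obtain ⟨f, hf, hsub⟩ := h
  have hf' : ∀ n, ‖WeakDual.toStrongDual (f n)‖ ≤ 1 := fun n => by
    simpa [dualUnitBall] using hf n
  obtain ⟨α, β, ρ, φ, hρ, hρd, -, hind⟩ := exists_independent_subsequence
    (fun n => WeakDual.toStrongDual (f n)) hf' fun ψ hψ => by
      by_contra hcon
      push Not at hcon
      obtain ⟨γ, hγ, hlim⟩ := exists_tendsto_of_pointwise (fun n => hf' (ψ n)) hcon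
      exact hsub γ hγ ψ hψ hlim
  refine ⟨fun n => WeakDual.toStrongDual (f (φ n)), ‖α - β‖ / 8, fun n => hf' _,
    div_pos (by linarith) (by norm_num), fun w => ?_⟩
  obtain ⟨N, hN⟩ := w.support.exists_nat_subset_range
  have := le_norm_sum_of_independent hρd N (hind N) w
  rw [l1Norm, Finsupp.linearCombination_apply, Finsupp.sum_of_support_subset _ hN _ (by simp),
    Finsupp.sum_of_support_subset _ hN _ (by simp)]
  exact this

theorem hasSeparableQuotient_of_not_isSeqCompact [CompleteSpace X]
    (h : ¬ IsSeqCompact (dualUnitBall 𝕜 X)) :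
    HasSeparableQuotientIsoTo 𝕜 X (CZero 𝕜) ∨ HasSeparableQuotientIsoTo 𝕜 X (EllTwo 𝕜) := by
  obtain ⟨g, c, hg, hc, hl⟩ := exists_l1_sequence_of_not_isSeqCompact h
  obtain ⟨w, hw, hst⟩ := exists_stable_isBlockSeq hg
  rcases (tailSize_nonneg (g := g) w).eq_or_lt with h0 | hpos
  · exact .inl (hasSeparableQuotientIsoTo_cZero_of_tailSize_eq_zero hg hc hl hw h0.symm)
  · right
    obtain ⟨x, hx⟩ := hw.exists_attainsSigns hg hst hpos (κ := tailSize g w / 16) (by positivity)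
      (by linarith)
    have hG : ∀ n, ‖Finsupp.linearCombination 𝕜 g (w n)‖ ≤ 1 := fun n =>
      (norm_linearCombination_le g hg (w n)).trans (hw.norm_eq n).le
    exact hasSeparableQuotientIsoTo_ellTwo_of_signs hpos (κ := tailSize g w / 16) (by linarith)
      (hx 0).1 fun σ => exists_dual_signs hG hx σ

end Main

theorem mainTheorem7 (𝕜 : Type*) [RCLike 𝕜] (X : Type*) [NormedAddCommGroup X] [NormedSpace 𝕜 X]
    [CompleteSpace X] :
    (¬ IsSeqCompact (dualUnitBall 𝕜 X) →
      HasSeparableQuotientIsoTo 𝕜 X (CZero 𝕜) ∨ HasSeparableQuotientIsoTo 𝕜 X (EllTwo 𝕜)) ∧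
    (IsSeqCompact (dualUnitBall 𝕜 X) →
      (ContainsCopy 𝕜 X (CZero 𝕜) ↔ ContainsComplementedCopy 𝕜 X (CZero 𝕜))) := by
  refine ⟨hasSeparableQuotient_of_not_isSeqCompact, fun hs =>
    ⟨fun h => h.containsComplementedCopy hs, ?_⟩⟩
  rintro ⟨M, hM, -, hiso⟩
  exact ⟨M, hM, hiso⟩
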